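/- Let $A$ and $B$ be $C^*$-algebras (not necessarily unital), let $\rho : A \to B$ be an injective $*$-homomorphism, let $\mathscr{A} \subseteq A$ be a norm-dense $*$-subalgebra, and let $\delta : \mathscr{A} \to B$ be a linear map with $\delta(a_1 a_2) = \delta(a_1)\rho(a_2) + \rho(a_1)\delta(a_2)$ and $\delta(a^*) = -\delta(a)^*$ for all $a, a_1, a_2 \in \mathscr{A}$, which is closed: if $a_n \in \mathscr{A}$, $a_n \to 0$ in $A$ and $\delta(a_n) \to b$ in $B$, then $b = 0$. Let $X$ be a (right) Hilbert $C^*$-module over $A$ for which there is a sequence $(\xi_n)_{n \ge 1}$ in $X$ such that $\langle \xi_n, \xi_m\rangle \in \mathscr{A}$ for all $n, m$ and such that the set of finite sums $\sum_{n=1}^N \xi_n a_n$ with $a_n \in A$ is dense in $X$. Let $H_A$ be the standard Hilbert $C^*$-module of sequences $(a_n)_{n\ge1}$ in $A$ for which $\sum_n a_n^* a_n$ converges in norm, with $\langle (a_n), (b_n)\rangle = \sum_n a_n^* b_n$, and let $\mathscr{K}(H_A)$ be the compact operators on $H_A$, that is, the operator norm closure of the linear span of the operators $z \mapsto x\langle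 y, z\rangle$ with $x, y \in H_A$. Let $\mathscr{K}(H_A)_\delta \subseteq \mathscr{K}(H_A)$ be the completion of the $*$-algebra $M_\infty(\mathscr{A})$ of finite matrices over $\mathscr{A}$ in the norm $\|a\|_\delta = \|a\| + \|\delta(a)\|$, where $\delta(a) = (\delta(a_{ij}))$ and $\|a\|$, $\|\delta(a)\|$ are the norms of $a$ and $\delta(a)$ as operators on $H_A$ and $H_B$. In other words, $\mathscr{K}(H_A)_\delta$ consists of the operator norm limits of $\|\cdot\|_\delta$-Cauchy sequences in $M_\infty(\mathscr{A})$. Then there exist a bounded adjointable isometry $W : X \to H_A$ and a positive selfadjoint bounded operator $K : H_A \to H_A$ such that, with $P := W W^*$ the associated orthogonal projection, 1. $K P = P K$; 2. $W^* K W : X \to X$ has dense image; 3. $P K \in \mathscr{K}(H_A)$; 4. $P K^2 \in \mathscr{K}(H_A)_\delta$. -/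

import Mathlib

open Filter Topology MulOpposite
open scoped RightActions

namespace DiffAbsorption

/-! ### Right Hilbert modules

The class `CStarModule R E` has `⟪x, r • y⟫ = r * ⟪x, y⟫`.  A (right) Hilbert C*-module over `A` in
the usual sense, with `⟨x, y a⟩ = ⟨x, y⟩ a`, is therefore a complete `CStarModule Aᵐᵒᵖ E`. -/

section RightInner

variable {A E : Type*} [NonUnitalCStarAlgebra A] [PartialOrder A]
  [AddCommGroup E] [Module ℂ E] [SMul Aᵐᵒᵖ E] [Norm E] [CStarModule Aᵐᵒᵖ E]

/-- The `A`-valued inner product of a right Hilbert module over `A`: conjugate linear in the first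
variable and `A`-linear in the second one. -/
def rinner (A : Type*) {E : Type*} [Inner Aᵐᵒᵖ E] (x y : E) : A := unop (inner Aᵐᵒᵖ x y)

theorem rinner_smul_right (x y : E) (a : A) : rinner A x (y <• a) = rinner A x y * a := by
  simp [rinner]

theorem star_rinner (x y : E) : star (rinner A x y) = rinner A y x := by
  rw [rinner, ← unop_star, CStarModule.star_inner]; rfl

/-- The set `{∑_{n < N} ξ_n a_n | N ∈ ℕ, a_n ∈ A}`. -/
def rightSpan (A : Type*) {E : Type*} [AddCommGroup E] [SMul Aᵐᵒᵖ E] (ξ : ℕ → E) : Set E :=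
  {x | ∃ (N : ℕ) (a : ℕ → A), x = ∑ n ∈ Finset.range N, ξ n <• a n}

end RightInner

/-! ### The standard module -/

section StdModule

variable {A : Type*} [NonUnitalCStarAlgebra A]

section Aux

variable [PartialOrder A] [StarOrderedRing A]

theorem norm_sum_star_mul_le (s : Finset ℕ) (x y : ℕ → A) :
    ‖∑ n ∈ s, star (x n) * y n‖ ≤
      √‖∑ n ∈ s, star (x n) * x n‖ * √‖∑ n ∈ s, star (y n) * y n‖ := by
  have h := CStarModule.norm_inner_le (A := A) (WithCStarModule A ((_i : s) → A))
    (x := (WithCStarModule.equiv A ((_i : s) → A)).symm fun i => star (y i))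
    (y := (WithCStarModule.equiv A ((_i : s) → A)).symm fun i => star (x i))
  simp only [WithCStarModule.pi_inner, WithCStarModule.pi_norm, WithCStarModule.inner_def,
    WithCStarModule.equiv_symm_pi_apply, star_star] at h
  rw [Finset.sum_coe_sort s (fun n => star (x n) * y n),
    Finset.sum_coe_sort s (fun n => star (x n) * x n),
    Finset.sum_coe_sort s (fun n => star (y n) * y n)] at h
  linarith

/-- For the series `∑ a_n^* a_n`, convergence of the partial sums is summability. -/
theorem summable_iff_cauchySeq (x : ℕ → A) :
    Summable (fun n => star (x n) * x n) ↔
      CauchySeq (fun N => ∑ n ∈ Finset.range N, star (x n) * x n) := by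
  refine ⟨fun h => h.hasSum.tendsto_sum_nat.cauchySeq, fun h => ?_⟩
  rw [summable_iff_vanishing_norm]
  intro ε hε
  obtain ⟨N, hN⟩ := Metric.cauchySeq_iff'.1 h ε hε
  refine ⟨Finset.range N, fun t ht => ?_⟩
  obtain ⟨M, hM⟩ := t.exists_nat_subset_range
  have hsub : t ⊆ Finset.Ico N (max M N) := by
    intro i hi
    have h1 := Finset.mem_range.1 (hM hi)
    have h2 : ¬ i < N := fun h => Finset.disjoint_left.1 ht hi (Finset.mem_range.2 h)
    rw [Finset.mem_Ico]
    exact ⟨by omega, lt_of_lt_of_le h1 (le_max_left _ _)⟩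
  have h3 := hN (max M N) (le_max_right _ _)
  rw [dist_eq_norm, ← Finset.sum_Ico_eq_sub _ (le_max_right M N)] at h3
  refine lt_of_le_of_lt ?_ h3
  exact CStarAlgebra.norm_le_norm_of_nonneg_of_le
    (Finset.sum_nonneg fun i _ => star_mul_self_nonneg _)
    (Finset.sum_le_sum_of_subset_of_nonneg hsub fun i _ _ => star_mul_self_nonneg _)

theorem summable_star_mul {x y : ℕ → A} (hx : Summable fun n => star (x n) * x n)
    (hy : Summable fun n => star (y n) * y n) : Summable fun n => star (x n) * y n := by
  rw [summable_iff_vanishing_norm] at hx hy ⊢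
  intro ε hε
  obtain ⟨s, hs⟩ := hx ε hε
  obtain ⟨t, ht⟩ := hy ε hε
  refine ⟨s ∪ t, fun u hu => ?_⟩
  rw [Finset.disjoint_union_right] at hu
  refine (norm_sum_star_mul_le u x y).trans_lt ?_
  calc _ < √ε * √ε := by
        have h1 := Real.sqrt_lt_sqrt (norm_nonneg _) (hs u hu.1)
        have h2 := Real.sqrt_lt_sqrt (norm_nonneg _) (ht u hu.2)
        exact mul_lt_mul'' h1 h2 (Real.sqrt_nonneg _) (Real.sqrt_nonneg _)
    _ = ε := Real.mul_self_sqrt hε.le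

end Aux

variable (A) in
/-- The sequences `(a_n)` in `A` for which `∑ a_n^* a_n` converges in norm. -/
def stdSubmodule [PartialOrder A] [StarOrderedRing A] : Submodule ℂ (ℕ → A) where
  carrier := {x | Summable fun n => star (x n) * x n}
  zero_mem' := by simp
  add_mem' := by
    intro x y hx hy
    have := ((hx.add (summable_star_mul hx hy)).add (summable_star_mul hy hx)).add hy
    refine this.congr fun n => ?_
    simp [add_mul, mul_add]; abel
  smul_mem' := by
    intro c x hx
    refine (Summable.const_smul (star c * c) hx).congr fun n => ?_
    simp [smul_mul_smul_comm]

variable (A) in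
/-- The standard module `H_A`. -/
def StdModule [PartialOrder A] [StarOrderedRing A] : Type _ := stdSubmodule A

namespace StdModule

variable [PartialOrder A] [StarOrderedRing A]

noncomputable instance : AddCommGroup (StdModule A) :=
  inferInstanceAs (AddCommGroup (stdSubmodule A))

noncomputable instance : Module ℂ (StdModule A) := inferInstanceAs (Module ℂ (stdSubmodule A))

instance : CoeFun (StdModule A) fun _ => ℕ → A := ⟨fun x => x.1⟩

theorem summable (x y : StdModule A) : Summable fun n => star (x n) * y n :=
  summable_star_mul x.2 y.2

@[ext] theorem ext {x y : StdModule A} (h : ∀ n, x n = y n) : x = y := Subtype.ext (funext h)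

@[simp] theorem add_apply (x y : StdModule A) (n : ℕ) : (x + y) n = x n + y n := rfl
@[simp] theorem zero_apply (n : ℕ) : (0 : StdModule A) n = 0 := rfl
@[simp] theorem smul_apply (c : ℂ) (x : StdModule A) (n : ℕ) : (c • x) n = c • x n := rfl

/-- The right action `(a_n) a = (a_n a)`. -/
instance : SMul Aᵐᵒᵖ (StdModule A) where
  smul a x := ⟨fun n => x n * unop a, by
    refine ((x.2.mul_left (star (unop a))).mul_right (unop a)).congr fun n => ?_
    simp [mul_assoc]⟩

@[simp] theorem op_smul_apply (a : A) (x : StdModule A) (n : ℕ) : (x <• a) n = x n * a := rfl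

/-- The inner product `⟨(a_n), (b_n)⟩ = ∑ a_n^* b_n`. -/
noncomputable instance : Inner Aᵐᵒᵖ (StdModule A) where
  inner x y := op (∑' n, star (x n) * y n)

theorem rinner_eq (x y : StdModule A) : rinner A x y = ∑' n, star (x n) * y n := rfl

noncomputable instance : Norm (StdModule A) where
  norm x := √‖rinner A x x‖

noncomputable instance : CStarModule Aᵐᵒᵖ (StdModule A) where
  inner_add_right {x y z} := by
    apply unop_injective
    change ∑' n, star (x n) * (y n + z n) = ∑' n, star (x n) * y n + ∑' n, star (x n) * z n
    rw [← (summable x y).tsum_add (summable x z)]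
    simp only [mul_add]
  inner_self_nonneg {x} := by
    change (0 : A) ≤ ∑' n, star (x n) * x n
    exact tsum_nonneg fun n => star_mul_self_nonneg _
  inner_self {x} := by
    constructor
    · intro h
      have h' : ∑' n, star (x n) * x n = 0 := congrArg unop h
      ext n
      have h1 := (summable x x).le_tsum n fun j _ => star_mul_self_nonneg (x j)
      rw [h'] at h1
      exact (CStarRing.star_mul_self_eq_zero_iff _).1 (le_antisymm h1 (star_mul_self_nonneg _))
    · rintro rfl
      apply unop_injective
      change ∑' n, star (0 : A) * 0 = 0
      simp
  inner_op_smul_right {a x y} := by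
    apply unop_injective
    change ∑' n, star (x n) * (y n * unop a) = (∑' n, star (x n) * y n) * unop a
    rw [← (summable x y).tsum_mul_right]
    simp only [mul_assoc]
  inner_smul_right_complex {z x y} := by
    apply unop_injective
    change ∑' n, star (x n) * (z • y n) = z • ∑' n, star (x n) * y n
    rw [← (summable x y).tsum_const_smul]
    simp only [mul_smul_comm]
  star_inner x y := by
    apply unop_injective
    change star (∑' n, star (x n) * y n) = ∑' n, star (y n) * x n
    rw [tsum_star]
    simp
  norm_eq_sqrt_norm_inner_self x := rfl

noncomputable instance : NormedAddCommGroup (StdModule A) := CStarModule.normedAddCommGroup Aᵐᵒᵖ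

noncomputable instance : NormedSpace ℂ (StdModule A) :=
  .ofCore (CStarModule.normedSpaceCore Aᵐᵒᵖ)

theorem norm_eq (x : StdModule A) : ‖x‖ = √‖∑' n, star (x n) * x n‖ := rfl

theorem norm_apply_le (x : StdModule A) (n : ℕ) : ‖x n‖ ≤ ‖x‖ := by
  rw [norm_eq]
  apply Real.le_sqrt_of_sq_le
  rw [sq, ← CStarRing.norm_star_mul_self]
  exact CStarAlgebra.norm_le_norm_of_nonneg_of_le (star_mul_self_nonneg _)
    ((summable x x).le_tsum n fun j _ => star_mul_self_nonneg (x j))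

/-- The sequence `e_i a` with `a` in position `i` and zeros elsewhere. -/
noncomputable def single (i : ℕ) (a : A) : StdModule A :=
  ⟨Pi.single i a, by
    refine summable_of_ne_finset_zero (s := {i}) fun n hn => ?_
    simp [Pi.single_eq_of_ne (Finset.notMem_singleton.1 hn)]⟩

theorem single_apply (i : ℕ) (a : A) (n : ℕ) : single i a n = if n = i then a else 0 :=
  Pi.single_apply i a n

theorem norm_single (i : ℕ) (a : A) : ‖single i a‖ = ‖a‖ := by
  have h : ∑' n, star (single i a n) * single i a n = star a * a := by
    rw [tsum_eq_single i fun n hn => by simp [single_apply, hn]]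
    simp [single_apply]
  rw [norm_eq, h, CStarRing.norm_star_mul_self, Real.sqrt_mul_self (norm_nonneg _)]

/-- The operator `(x_n) ↦ e_i (c x_j)`: the matrix with `c` in position `(i, j)`. -/
noncomputable def matrixUnit (i j : ℕ) (c : A) : StdModule A →L[ℂ] StdModule A :=
  LinearMap.mkContinuous
    { toFun := fun x => single i (c * x j)
      map_add' := fun x y => by
        ext n
        by_cases h : n = i <;> simp [single_apply, h, mul_add]
      map_smul' := fun z x => by
        ext n
        by_cases h : n = i <;> simp [single_apply, h, mul_smul_comm] } ‖c‖ fun x => by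
    change ‖single i (c * x j)‖ ≤ _
    rw [norm_single]
    exact (norm_mul_le _ _).trans (by gcongr; exact norm_apply_le x j)

theorem matrixUnit_apply (i j : ℕ) (c : A) (x : StdModule A) :
    matrixUnit i j c x = single i (c * x j) := rfl

/-- The operator on `H_A` given by a finite matrix over `A`. -/
noncomputable def matrixOp (a : ℕ × ℕ →₀ A) : StdModule A →L[ℂ] StdModule A :=
  ∑ p ∈ a.support, matrixUnit p.1 p.2 (a p)

/-- `matrixOp a` is matrix multiplication by `a`. -/
theorem matrixOp_apply (a : ℕ × ℕ →₀ A) (x : StdModule A) (N : ℕ)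
    (ha : a.support ⊆ Finset.range N ×ˢ Finset.range N) (i : ℕ) :
    matrixOp a x i = ∑ j ∈ Finset.range N, a (i, j) * x j := by
  have hsum : ∀ (s : Finset (ℕ × ℕ)) (f : ℕ × ℕ → StdModule A),
      (∑ p ∈ s, f p) i = ∑ p ∈ s, f p i := fun s f =>
    map_sum ((LinearMap.proj i : (ℕ → A) →ₗ[ℂ] A) ∘ₗ (stdSubmodule A).subtype) f s
  have h0 : matrixOp a = ∑ p ∈ Finset.range N ×ˢ Finset.range N, matrixUnit p.1 p.2 (a p) := by
    refine Finset.sum_subset ha fun p _ hp => ?_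
    rw [Finsupp.notMem_support_iff.1 hp]
    ext x n
    simp [matrixUnit_apply, single_apply]
  rw [h0, _root_.sum_apply, hsum, Finset.sum_product]
  simp only [matrixUnit_apply, single_apply]
  by_cases hi : i ∈ Finset.range N
  · rw [Finset.sum_eq_single_of_mem i hi fun k _ hk => by simp [hk.symm]]
    simp
  · rw [Finset.sum_eq_zero fun k hk => Finset.sum_eq_zero fun j _ => if_neg fun h => hi (by rwa [h])]
    refine (Finset.sum_eq_zero fun j _ => ?_).symm
    have : a (i, j) = 0 := by
      by_contra h
      exact hi (Finset.mem_product.1 (ha (Finsupp.mem_support_iff.2 h))).1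
    rw [this, zero_mul]

end StdModule

end StdModule

/-! ### Adjointable, positive and compact operators -/

section Operators

variable (A : Type*) [NonUnitalCStarAlgebra A] [PartialOrder A] [StarOrderedRing A]
  {E F : Type*} [NormedAddCommGroup E] [NormedSpace ℂ E] [SMul Aᵐᵒᵖ E] [CStarModule Aᵐᵒᵖ E]
  [NormedAddCommGroup F] [NormedSpace ℂ F] [SMul Aᵐᵒᵖ F] [CStarModule Aᵐᵒᵖ F]

/-- `S` is the adjoint of `T`: `⟨T x, y⟩ = ⟨x, S y⟩`. -/
def IsAdjoint (T : E →L[ℂ] F) (S : F →L[ℂ] E) : Prop :=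
  ∀ x y, rinner A (T x) y = rinner A x (S y)

/-- A bounded selfadjoint operator `T` with `⟨x, T x⟩ ≥ 0` for all `x`. -/
def IsPositiveOp (T : E →L[ℂ] E) : Prop :=
  IsAdjoint A T T ∧ ∀ x, 0 ≤ rinner A x (T x)

/-- `T` is a rank one operator `z ↦ x ⟨y, z⟩`. -/
def IsRankOne (T : E →L[ℂ] F) : Prop :=
  ∃ (x : F) (y : E), ∀ z, T z = x <• rinner A y z

/-- The compact operators in the sense of Hilbert modules: the operator norm closure of the linear
span of the rank one operators. -/
def compactOps : Set (E →L[ℂ] F) :=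
  closure (Submodule.span ℂ {T : E →L[ℂ] F | IsRankOne A T} : Set (E →L[ℂ] F))

end Operators

/-! ### Closed derivations and differentiable compact operators -/

section Derivation

variable {A B : Type*} [NonUnitalCStarAlgebra A] [NonUnitalCStarAlgebra B]

/-- A closed derivation `δ : 𝒜 → B` along `ρ : A → B`, with `δ(a^*) = -δ(a)^*`. -/
structure IsClosedDerivation (ρ : A →⋆ₙₐ[ℂ] B) {𝒜 : NonUnitalStarSubalgebra ℂ A}
    (δ : 𝒜 →ₗ[ℂ] B) : Prop where
  leibniz : ∀ a b : 𝒜, δ (a * b) = δ a * ρ b + ρ a * δ b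
  map_star : ∀ a : 𝒜, δ (star a) = -star (δ a)
  closed : ∀ (a : ℕ → 𝒜) (b : B), Tendsto (fun n => (a n : A)) atTop (𝓝 0) →
    Tendsto (fun n => δ (a n)) atTop (𝓝 b) → b = 0

variable [PartialOrder A] [StarOrderedRing A] [PartialOrder B] [StarOrderedRing B]
  {𝒜 : NonUnitalStarSubalgebra ℂ A}

/-- The operator on `H_A` given by a finite matrix over `𝒜`. -/
noncomputable def matOp (a : ℕ × ℕ →₀ 𝒜) : StdModule A →L[ℂ] StdModule A :=
  StdModule.matrixOp (a.mapRange (fun c : 𝒜 => (c : A)) rfl)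

/-- The operator on `H_B` given by the finite matrix `δ(a)`, with entries `δ(a_ij)`. -/
noncomputable def derivOp (δ : 𝒜 →ₗ[ℂ] B) (a : ℕ × ℕ →₀ 𝒜) : StdModule B →L[ℂ] StdModule B :=
  StdModule.matrixOp (a.mapRange δ (map_zero δ))

/-- The norm `‖a‖_δ = ‖a‖ + ‖δ(a)‖` of a finite matrix `a` over `𝒜`. -/
noncomputable def deltaNorm (δ : 𝒜 →ₗ[ℂ] B) (a : ℕ × ℕ →₀ 𝒜) : ℝ :=
  ‖matOp a‖ + ‖derivOp δ a‖

/-- The differentiable compact operators `𝒦(H_A)_δ`: the completion of the finite matrices over `𝒜`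
in the norm `‖·‖_δ`, realised inside the operators on `H_A` (which is possible as `δ` is closed): the
operators that are limits in operator norm of `‖·‖_δ`-Cauchy sequences of finite matrices. -/
def diffCompactOps (δ : 𝒜 →ₗ[ℂ] B) : Set (StdModule A →L[ℂ] StdModule A) :=
  {T | ∃ a : ℕ → (ℕ × ℕ →₀ 𝒜),
    (∀ ε > 0, ∃ N, ∀ m ≥ N, ∀ n ≥ N, deltaNorm δ (a m - a n) < ε) ∧
    Tendsto (fun n => matOp (a n)) atTop (𝓝 T)}

end Derivation

end DiffAbsorption

/-! Rescale the generators so that `‖ξ_i‖ ≤ w_i` and the derivatives of `⟨ξ_i, ξ_j⟩` are at most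
`w_i w_j`, with `w` summable and `∑ w_i² < 1`. Put `h = ∑ ξ_i ⟨ξ_i, ·⟩`, a positive compact
contraction, `q = 2 (1 + h)⁻¹` and `r = (1 - h)(1 + h)⁻¹ = q - 1`. Then `1 - r² = q h q`, so `∑_{k <
N} r^k q h q r^k = 1 - r^(2N)`. Since `r^N → 0` strongly (`tendsto_cay_pow`), the vectors `q r^k
ξ_i` form a Parseval frame (`isParsevalFrame`). Its analysis operator is `W`, its synthesis operator
is `W*`, and `K = W h^18 W*`. As `W* W = 1`, one gets `P K = K = K P`, `W* K W = h^18` and `P K² = W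
h^36 W*`. Compactness comes from that of `h`, and dense image from `1 - r^k ∈ h · (operators)`
together with `r^k → 0`.

The hard point is the differentiability of `W h^36 W*`. Its matrix entries are `⟨ξ_i, q h^36 r^(k+l)
q ξ_j⟩`, and it suffices that they and their derivatives are `O(w_i w_j (k+l+1)^(-6))`, which is
absolutely summable. Two estimates give this. The norm of `h^16 r^k` is `O(k^(-8))`, by a
telescoping argument and repeated halving of `k` (`exists_norm_gram_pow_mul_cay_pow_le`). The
derivative of the matrix of `r^n` grows at most quadratically (`exists_hasDerivBound_cay_pow`),
because right multiplication by the matrix counterpart of `r^b` has norm `O(b)`. Writing a high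
power of `h` times `r^N` as a product of two similar halves, the Leibniz rule pairs quadratic growth
with decay of order 8. -/

set_option linter.unusedSectionVars false

namespace DiffAbsorption

/-! ### Inner products, rank one operators and adjoints on Hilbert modules. -/

section InnerProduct

variable {A : Type*} [NonUnitalCStarAlgebra A] [PartialOrder A] [StarOrderedRing A]
  {E F G : Type*} [NormedAddCommGroup E] [NormedSpace ℂ E] [SMul Aᵐᵒᵖ E] [CStarModule Aᵐᵒᵖ E]
  [NormedAddCommGroup F] [NormedSpace ℂ F] [SMul Aᵐᵒᵖ F] [CStarModule Aᵐᵒᵖ F]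
  [NormedAddCommGroup G] [NormedSpace ℂ G] [SMul Aᵐᵒᵖ G] [CStarModule Aᵐᵒᵖ G]

variable (A) in
/-- The inner product as a continuous linear functional of its second variable. -/
noncomputable def rinnerCLM (x : E) : E →L[ℂ] A :=
  LinearMap.mkContinuous
    { toFun := fun y => rinner A x y
      map_add' := fun y z => by simp [rinner]
      map_smul' := fun c y => by simp [rinner] } ‖x‖ fun y => by
    exact CStarModule.norm_inner_le (A := Aᵐᵒᵖ) E

@[simp] theorem rinnerCLM_apply (x y : E) : rinnerCLM A x y = rinner A x y := rfl

theorem norm_rinner_le (x y : E) : ‖rinner A x y‖ ≤ ‖x‖ * ‖y‖ :=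
  CStarModule.norm_inner_le (A := Aᵐᵒᵖ) E

theorem norm_sq_eq_rinner (x : E) : ‖x‖ ^ 2 = ‖rinner A x x‖ :=
  CStarModule.norm_sq_eq Aᵐᵒᵖ

theorem rinner_self_nonneg (x : E) : 0 ≤ rinner A x x :=
  CStarModule.inner_self_nonneg (A := Aᵐᵒᵖ) (x := x)

theorem rinner_add_right (x y z : E) : rinner A x (y + z) = rinner A x y + rinner A x z :=
  map_add (rinnerCLM A x) y z

theorem rinner_sub_right (x y z : E) : rinner A x (y - z) = rinner A x y - rinner A x z :=
  map_sub (rinnerCLM A x) y z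

theorem rinner_smul_complex_right (x y : E) (c : ℂ) : rinner A x (c • y) = c • rinner A x y :=
  map_smul (rinnerCLM A x) c y

theorem rinner_smul_complex_left (x y : E) (c : ℂ) :
    rinner A (c • x) y = star c • rinner A x y := by
  rw [← star_rinner y, rinner_smul_complex_right, star_smul, star_rinner]

theorem rinner_smul_left (x y : E) (a : A) : rinner A (x <• a) y = star a * rinner A x y := by
  rw [← star_rinner y, rinner_smul_right, star_mul, star_rinner]

theorem ext_rinner {x y : E} (h : ∀ z, rinner A z x = rinner A z y) : x = y := by
  rw [← sub_eq_zero, ← norm_eq_zero, ← sq_eq_zero_iff, norm_sq_eq_rinner (A := A),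
    rinner_sub_right, h, sub_self, norm_zero]

theorem norm_le_of_rinner_le {x : E} {y : F} (h : rinner A x x ≤ rinner A y y) : ‖x‖ ≤ ‖y‖ := by
  refine le_of_sq_le_sq ?_ (norm_nonneg _)
  rw [norm_sq_eq_rinner (A := A), norm_sq_eq_rinner (A := A)]
  exact CStarAlgebra.norm_le_norm_of_nonneg_of_le (rinner_self_nonneg x) h

theorem norm_op_smul_le (x : E) (a : A) : ‖x <• a‖ ≤ ‖x‖ * ‖a‖ := by
  refine le_of_sq_le_sq ?_ (by positivity)
  rw [norm_sq_eq_rinner (A := A), rinner_smul_right, rinner_smul_left, mul_pow,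
    norm_sq_eq_rinner (A := A) x]
  calc _ ≤ ‖star a‖ * ‖rinner A x x‖ * ‖a‖ := norm_mul₃_le
    _ = _ := by rw [norm_star]; ring

/-- The map `a ↦ x a`. -/
noncomputable def opSMulCLM (x : E) : A →L[ℂ] E :=
  LinearMap.mkContinuous
    { toFun := fun a => x <• a
      map_add' := fun a b => ext_rinner (A := A) fun z => by
        simp only [rinner_smul_right, rinner_add_right, mul_add]
      map_smul' := fun c a => ext_rinner (A := A) fun z => by
        simp only [rinner_smul_right, rinner_smul_complex_right, mul_smul_comm, RingHom.id_apply] }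
    ‖x‖ (norm_op_smul_le x)

variable (A) in
/-- The rank one operator `z ↦ x ⟨y, z⟩`. -/
noncomputable def rankOne (x : F) (y : E) : E →L[ℂ] F := (opSMulCLM x).comp (rinnerCLM A y)

@[simp] theorem rankOne_apply (x : F) (y z : E) : rankOne A x y z = x <• rinner A y z := rfl

theorem norm_rankOne_le (x : F) (y : E) : ‖rankOne A x y‖ ≤ ‖x‖ * ‖y‖ := by
  refine ContinuousLinearMap.opNorm_le_bound _ (by positivity) fun z => ?_
  rw [rankOne_apply, mul_assoc]
  exact (norm_op_smul_le _ _).trans (by gcongr; exact norm_rinner_le y z)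

theorem isRankOne_rankOne (x : F) (y : E) : IsRankOne A (rankOne A x y) := ⟨x, y, fun _ => rfl⟩

namespace IsAdjoint

theorem symm {T : E →L[ℂ] F} {S : F →L[ℂ] E} (h : IsAdjoint A T S) : IsAdjoint A S T :=
  fun x y => by rw [← star_rinner y, ← h, star_rinner]

theorem map_op_smul {T : E →L[ℂ] F} {S : F →L[ℂ] E} (h : IsAdjoint A T S) (x : E) (a : A) :
    T (x <• a) = T x <• a :=
  ext_rinner (A := A) fun z => by rw [← h.symm, rinner_smul_right, rinner_smul_right, h.symm]

theorem comp {T : E →L[ℂ] F} {S : F →L[ℂ] E} {T' : F →L[ℂ] G} {S' : G →L[ℂ] F}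
    (h' : IsAdjoint A T' S') (h : IsAdjoint A T S) : IsAdjoint A (T' ∘L T) (S ∘L S') :=
  fun _ _ => (h' _ _).trans (h _ _)

theorem one : IsAdjoint A (1 : E →L[ℂ] E) 1 := fun _ _ => rfl

theorem mul {T S T' S' : E →L[ℂ] E} (h : IsAdjoint A T S) (h' : IsAdjoint A T' S') :
    IsAdjoint A (T * T') (S' * S) := h.comp h'

theorem add {T T' : E →L[ℂ] F} {S S' : F →L[ℂ] E} (h : IsAdjoint A T S) (h' : IsAdjoint A T' S') :
    IsAdjoint A (T + T') (S + S') := fun x y => by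
  rw [← star_rinner y]
  simp only [_root_.add_apply, rinner_add_right, star_add, star_rinner, h x y, h' x y]

theorem smul {T : E →L[ℂ] F} {S : F →L[ℂ] E} (h : IsAdjoint A T S) (c : ℂ) :
    IsAdjoint A (c • T) (star c • S) := fun x y => by
  simp only [_root_.smul_apply, rinner_smul_complex_left, rinner_smul_complex_right, h x y]

theorem sub {T T' : E →L[ℂ] F} {S S' : F →L[ℂ] E} (h : IsAdjoint A T S) (h' : IsAdjoint A T' S') :
    IsAdjoint A (T - T') (S - S') := by
  simpa [sub_eq_add_neg] using h.add (h'.smul (-1))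

theorem pow {T : E →L[ℂ] E} (h : IsAdjoint A T T) (n : ℕ) : IsAdjoint A (T ^ n) (T ^ n) := by
  induction n with
  | zero => exact one
  | succ n ih => simpa only [← pow_succ, ← pow_succ'] using ih.mul h

theorem rinner_apply_left {T : E →L[ℂ] F} {S : F →L[ℂ] E} (h : IsAdjoint A T S) (x : E) (y : F) :
    rinner A x (S y) = rinner A (T x) y := (h x y).symm

theorem rankOne (x : F) (y : E) : IsAdjoint A (rankOne A x y) (DiffAbsorption.rankOne A y x) :=
  fun z t => by
    rw [rankOne_apply, rankOne_apply, rinner_smul_left, rinner_smul_right, star_rinner]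

theorem hasSum {ι : Type*} {T : ι → E →L[ℂ] F} {S : ι → F →L[ℂ] E} {T' : E →L[ℂ] F}
    {S' : F →L[ℂ] E} (h : ∀ i, IsAdjoint A (T i) (S i)) (hT : HasSum T T') (hS : HasSum S S') :
    IsAdjoint A T' S' := fun x y => by
  have h1 : HasSum (fun i => rinner A y (T i x)) (rinner A y (T' x)) :=
    ((rinnerCLM A y).comp (ContinuousLinearMap.apply ℂ F x)).hasSum hT
  have h2 : HasSum (fun i => rinner A x (S i y)) (rinner A x (S' y)) :=
    ((rinnerCLM A x).comp (ContinuousLinearMap.apply ℂ E y)).hasSum hS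
  have h3 := h1.star
  simp only [star_rinner, (h _).rinner_apply_left] at h2 h3
  exact h3.unique h2

end IsAdjoint

end InnerProduct

/-- Bounded increasing nets need not converge in norm in a C*-algebra. Here one good finite sum is
enough: for `t ⊇ s` the remainder satisfies `0 ≤ a - ∑_t ≤ a - ∑_s`, and the norm is monotone on
positive elements. -/
theorem hasSum_of_sum_le_of_forall_exists {A ι : Type*} [NonUnitalCStarAlgebra A] [PartialOrder A]
    [StarOrderedRing A] {f : ι → A} {a : A} (hf : ∀ i, 0 ≤ f i) (hle : ∀ s, ∑ i ∈ s, f i ≤ a)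
    (h : ∀ ε > 0, ∃ s, ‖a - ∑ i ∈ s, f i‖ < ε) : HasSum f a := by
  refine Metric.tendsto_nhds.2 fun ε hε => ?_
  obtain ⟨s, hs⟩ := h ε hε
  rw [SummationFilter.unconditional_filter]
  filter_upwards [eventually_ge_atTop s] with t hst
  rw [dist_eq_norm, norm_sub_rev]
  refine lt_of_le_of_lt ?_ hs
  refine CStarAlgebra.norm_le_norm_of_nonneg_of_le (sub_nonneg.2 (hle t)) ?_
  exact sub_le_sub_left (Finset.sum_le_sum_of_subset_of_nonneg hst fun i _ _ => hf i) _

/-! ### Parseval frames and their analysis and synthesis operators. -/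

section Frame

variable {A X : Type*} [NonUnitalCStarAlgebra A] [PartialOrder A] [StarOrderedRing A]
  [NormedAddCommGroup X] [NormedSpace ℂ X] [SMul Aᵐᵒᵖ X] [CStarModule Aᵐᵒᵖ X]

variable (A) in
/-- A normalised (Parseval) frame: `∑ ⟨x, η_n⟩ ⟨η_n, x⟩ = ⟨x, x⟩` for all `x`. -/
def IsParsevalFrame (η : ℕ → X) : Prop :=
  ∀ x, HasSum (fun n => rinner A x (η n) * rinner A (η n) x) (rinner A x x)

namespace IsParsevalFrame

variable {η : ℕ → X} (hη : IsParsevalFrame A η)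
include hη

theorem summable (x : X) :
    Summable fun n => star (rinner A (η n) x) * rinner A (η n) x := by
  simpa only [star_rinner] using (hη x).summable

/-- The coefficient sequence of a vector in a Parseval frame. -/
noncomputable def coeff (x : X) : StdModule A := ⟨fun n => rinner A (η n) x, hη.summable x⟩

theorem coeff_apply (x : X) (n : ℕ) : hη.coeff x n = rinner A (η n) x := rfl

theorem rinner_coeff_self (x : X) : rinner A (hη.coeff x) (hη.coeff x) = rinner A x x := by
  rw [StdModule.rinner_eq, ← (hη x).tsum_eq]
  simp only [coeff_apply, star_rinner]

theorem norm_coeff (x : X) : ‖hη.coeff x‖ = ‖x‖ :=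
  le_antisymm (norm_le_of_rinner_le (hη.rinner_coeff_self x).le)
    (norm_le_of_rinner_le (hη.rinner_coeff_self x).ge)

/-- The analysis operator of a Parseval frame. -/
noncomputable def analysis : X →L[ℂ] StdModule A :=
  LinearMap.mkContinuous
    { toFun := hη.coeff
      map_add' := fun x y => by
        ext n
        simp only [coeff_apply, StdModule.add_apply, rinner_add_right]
      map_smul' := fun c x => by
        ext n
        simp only [coeff_apply, StdModule.smul_apply, rinner_smul_complex_right,
          RingHom.id_apply] } 1
    fun x => by simpa using (hη.norm_coeff x).le

theorem analysis_apply (x : X) (n : ℕ) : hη.analysis x n = rinner A (η n) x := rfl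

/-- With `y` the sum, `⟨y, y⟩ = ∑ ⟨η_n, y⟩^* a_n`. Cauchy-Schwarz and the Bessel inequality
contained in the frame identity give `‖y‖² ≤ ‖y‖ · √…`, and a factor `‖y‖` cancels. -/
theorem norm_sum_op_smul_le (s : Finset ℕ) (a : ℕ → A) :
    ‖∑ n ∈ s, η n <• a n‖ ≤ √‖∑ n ∈ s, star (a n) * a n‖ := by
  set y := ∑ n ∈ s, η n <• a n with hy
  have h1 : rinner A y y = ∑ n ∈ s, star (rinner A (η n) y) * a n := by
    have : ∀ z, rinner A z y = ∑ n ∈ s, rinner A z (η n) * a n := fun z => by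
      rw [hy, ← rinnerCLM_apply, map_sum]
      simp only [rinnerCLM_apply, rinner_smul_right]
    simpa only [star_rinner] using this y
  have h2 : ‖∑ n ∈ s, star (rinner A (η n) y) * rinner A (η n) y‖ ≤ ‖y‖ ^ 2 := by
    rw [norm_sq_eq_rinner (A := A)]
    refine CStarAlgebra.norm_le_norm_of_nonneg_of_le
      (Finset.sum_nonneg fun i _ => star_mul_self_nonneg _) ?_
    simp only [star_rinner]
    exact sum_le_hasSum s (fun i _ => by
      rw [← star_rinner (η i)]; exact star_mul_self_nonneg _) (hη y)
  have h3 := norm_sum_star_mul_le s (fun n => rinner A (η n) y) a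
  rw [← h1, ← norm_sq_eq_rinner] at h3
  have h4 : √‖∑ n ∈ s, star (rinner A (η n) y) * rinner A (η n) y‖ ≤ ‖y‖ :=
    Real.sqrt_le_iff.2 ⟨norm_nonneg _, h2⟩
  rcases (norm_nonneg y).eq_or_lt with h0 | h0
  · rw [← h0]; positivity
  · refine le_of_mul_le_mul_left ?_ h0
    rw [← sq]
    exact h3.trans (by gcongr)

variable [CompleteSpace X]

theorem summable_op_smul (a : StdModule A) : Summable fun n => η n <• a n := by
  rw [summable_iff_vanishing_norm]
  intro ε hε
  obtain ⟨s, hs⟩ := summable_iff_vanishing_norm.1 a.2 (ε ^ 2) (by positivity)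
  refine ⟨s, fun t ht => (hη.norm_sum_op_smul_le t _).trans_lt ?_⟩
  exact (Real.sqrt_lt_sqrt (norm_nonneg _) (hs t ht)).trans_eq (Real.sqrt_sq hε.le)

/-- The synthesis operator of a Parseval frame. -/
noncomputable def synthesis : StdModule A →L[ℂ] X :=
  LinearMap.mkContinuous
    { toFun := fun a => ∑' n, η n <• a n
      map_add' := fun a b => by
        rw [← (hη.summable_op_smul a).tsum_add (hη.summable_op_smul b)]
        exact tsum_congr fun n => map_add (opSMulCLM (η n)) (a n) (b n)
      map_smul' := fun c a => by
        rw [RingHom.id_apply, ← (hη.summable_op_smul a).tsum_const_smul]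
        exact tsum_congr fun n => map_smul (opSMulCLM (η n)) c (a n) } 1
    fun a => by
      rw [one_mul, StdModule.norm_eq]
      refine le_of_tendsto_of_tendsto (hη.summable_op_smul a).hasSum.norm
        (a.2.hasSum.norm.sqrt) (Eventually.of_forall fun s => ?_)
      exact hη.norm_sum_op_smul_le s _

theorem isAdjoint_analysis : IsAdjoint A hη.analysis hη.synthesis := fun x a => by
  have h := (rinnerCLM A x).hasSum (hη.summable_op_smul a).hasSum
  simp only [rinnerCLM_apply, rinner_smul_right] at h
  refine Eq.trans ?_ h.tsum_eq
  rw [StdModule.rinner_eq]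
  simp only [analysis_apply, star_rinner]

/-- Polarisation: the quadratic forms of `T = W* W` and of `1` agree. Comparing at `x + y` and
replacing `x` by `i x` separates the two cross terms. -/
theorem synthesis_analysis (x : X) : hη.synthesis (hη.analysis x) = x := by
  set T := hη.synthesis ∘L hη.analysis
  have hT : IsAdjoint A T T := hη.isAdjoint_analysis.symm.comp hη.isAdjoint_analysis
  have hq : ∀ x, rinner A x (T x) = rinner A x x := fun x =>
    (hη.isAdjoint_analysis x _).symm.trans (hη.rinner_coeff_self x)
  have hs : ∀ x y, rinner A x (T y - y) + rinner A y (T x - x) = 0 := fun x y => by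
    have h1 := hq (x + y)
    rw [map_add] at h1
    simp only [rinner_add_right] at h1
    have hl : ∀ z, rinner A (x + y) z = rinner A x z + rinner A y z := fun z => by
      rw [← star_rinner z, rinner_add_right, star_add, star_rinner, star_rinner]
    simp only [hl, hq] at h1
    simp only [rinner_sub_right]
    have h2 : rinner A y (T x) + rinner A x (T y) = rinner A y x + rinner A x y := by
      have h3 : ∀ a b c d e f : A, a + b + (c + d) = a + e + (f + d) → b + c = e + f := by
        intro a b c d e f h
        have : a + d + (b + c) = a + d + (e + f) := by
          calc _ = a + b + (c + d) := by abel
            _ = _ := h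
            _ = _ := by abel
        exact add_left_cancel this
      exact h3 _ _ _ _ _ _ h1
    rw [sub_add_sub_comm, add_comm, h2, add_comm (rinner A y x), sub_self]
  have hc : ∀ x y, rinner A x (T y - y) = 0 := fun x y => by
    have h1 := hs x y
    have h2 := hs (Complex.I • x) y
    have h3 : T (Complex.I • x) - Complex.I • x = Complex.I • (T x - x) := by
      rw [map_smul, smul_sub]
    rw [h3, rinner_smul_complex_left, rinner_smul_complex_right] at h2
    have h4 : rinner A y (T x - x) = -rinner A x (T y - y) := by
      rw [eq_neg_iff_add_eq_zero, add_comm]; exact h1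
    rw [h4, smul_neg, ← sub_eq_add_neg, ← sub_smul, smul_eq_zero] at h2
    refine h2.resolve_left ?_
    norm_num [Complex.ext_iff]
  have := hc (T x - x) x
  rw [← norm_eq_zero, ← norm_sq_eq_rinner, sq_eq_zero_iff, norm_eq_zero, sub_eq_zero] at this
  exact this

theorem rinner_analysis (x y : X) : rinner A (hη.analysis x) (hη.analysis y) = rinner A x y := by
  rw [hη.isAdjoint_analysis, synthesis_analysis]

end IsParsevalFrame

end Frame

/-- Conjugating by adjointable operators preserves compactness. -/
theorem comp_mem_compactOps {A E F G H : Type*} [NonUnitalCStarAlgebra A] [PartialOrder A]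
    [StarOrderedRing A]
    [NormedAddCommGroup E] [NormedSpace ℂ E] [SMul Aᵐᵒᵖ E] [CStarModule Aᵐᵒᵖ E]
    [NormedAddCommGroup F] [NormedSpace ℂ F] [SMul Aᵐᵒᵖ F] [CStarModule Aᵐᵒᵖ F]
    [NormedAddCommGroup G] [NormedSpace ℂ G] [SMul Aᵐᵒᵖ G] [CStarModule Aᵐᵒᵖ G]
    [NormedAddCommGroup H] [NormedSpace ℂ H] [SMul Aᵐᵒᵖ H] [CStarModule Aᵐᵒᵖ H]
    {S : F →L[ℂ] G} {S' : G →L[ℂ] F} (hS : IsAdjoint A S S')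
    {R : H →L[ℂ] E} {R' : E →L[ℂ] H} (hR : IsAdjoint A R R')
    {T : E →L[ℂ] F} (hT : T ∈ compactOps A) : S ∘L T ∘L R ∈ compactOps A := by
  let L : (E →L[ℂ] F) →L[ℂ] (H →L[ℂ] G) :=
    (ContinuousLinearMap.compL ℂ H F G S).comp ((ContinuousLinearMap.compL ℂ H E F).flip R)
  have hL : ∀ T, L T = S ∘L T ∘L R := fun _ => rfl
  rw [← hL]
  refine map_mem_closure L.continuous hT fun T hT => ?_
  induction hT using Submodule.span_induction with
  | mem T hT =>
    obtain ⟨x, y, h⟩ := hT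
    refine Submodule.subset_span ⟨S x, R' y, fun z => ?_⟩
    rw [hL]
    simp only [ContinuousLinearMap.comp_apply, h, hS.map_op_smul, hR.symm y z]
  | zero => simp
  | add T T' _ _ h h' => rw [map_add]; exact add_mem h h'
  | smul c T _ h => rw [map_smul]; exact Submodule.smul_mem _ c h

/-! ### The closure of the graph of the derivation. -/

section GraphClosure

variable {A B : Type*} [NonUnitalCStarAlgebra A] [NonUnitalCStarAlgebra B]
  {𝒜 : NonUnitalStarSubalgebra ℂ A}

/-- The closure in `A × B` of the graph of `δ`. -/
def graphClosure (δ : 𝒜 →ₗ[ℂ] B) : Submodule ℂ (A × B) :=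
  (LinearMap.range ((NonUnitalSubalgebraClass.subtype 𝒜 : 𝒜 →ₗ[ℂ] A).prod δ)).topologicalClosure

theorem mem_graphClosure (δ : 𝒜 →ₗ[ℂ] B) (a : 𝒜) : ((a : A), δ a) ∈ graphClosure δ :=
  Submodule.le_topologicalClosure _ ⟨a, rfl⟩

/-- The Leibniz rule is a continuous expression in both pairs, so it passes from the graph to its
closure. -/
theorem mul_mem_graphClosure {ρ : A →⋆ₙₐ[ℂ] B} {δ : 𝒜 →ₗ[ℂ] B} (hδ : IsClosedDerivation ρ δ)
    {p q : A × B} (hp : p ∈ graphClosure δ) (hq : q ∈ graphClosure δ) :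
    (p.1 * q.1, p.2 * ρ q.1 + ρ p.1 * q.2) ∈ graphClosure δ := by
  have hρ : Continuous ρ :=
    AddMonoidHomClass.continuous_of_bound ρ 1 fun a => by
      simpa using NonUnitalStarAlgHom.norm_apply_le ρ a
  refine map_mem_closure₂ (f := fun p q : A × B => (p.1 * q.1, p.2 * ρ q.1 + ρ p.1 * q.2))
    (by fun_prop) hp hq ?_
  rintro _ ⟨a, rfl⟩ _ ⟨b, rfl⟩
  exact ⟨a * b, Prod.ext rfl (hδ.leibniz a b)⟩

theorem hasSum_mem_graphClosure {δ : 𝒜 →ₗ[ℂ] B} {ι : Type*} {f : ι → A} {g : ι → B} {a : A} {b : B}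
    (h : ∀ i, (f i, g i) ∈ graphClosure δ) (hf : HasSum f a) (hg : HasSum g b) :
    (a, b) ∈ graphClosure δ :=
  (Submodule.isClosed_topologicalClosure _).mem_of_tendsto (hf.prodMk hg)
    (Eventually.of_forall fun _ => sum_mem fun i _ => h i)

end GraphClosure

/-! ### Completeness of `H_A`, and operators given by absolutely summable matrices. -/

section MatrixOperators

namespace StdModule

variable {A : Type*} [NonUnitalCStarAlgebra A] [PartialOrder A] [StarOrderedRing A]

/-- `matrixUnit i j` as a continuous linear map. -/
noncomputable def matrixUnitCLM (i j : ℕ) : A →L[ℂ] (StdModule A →L[ℂ] StdModule A) :=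
  LinearMap.mkContinuous
    { toFun := matrixUnit i j
      map_add' := fun c d => by
        ext x n
        by_cases h : n = i <;> simp [matrixUnit_apply, single_apply, h, add_mul]
      map_smul' := fun z c => by
        ext x n
        by_cases h : n = i <;> simp [matrixUnit_apply, single_apply, h, smul_mul_assoc] } 1
    fun c => by
      refine ContinuousLinearMap.opNorm_le_bound _ (by positivity) fun x => ?_
      change ‖single i (c * x j)‖ ≤ _
      rw [norm_single, one_mul]
      exact (norm_mul_le _ _).trans (by gcongr; exact norm_apply_le x j)

theorem norm_matrixUnit_le (i j : ℕ) (c : A) : ‖matrixUnit i j c‖ ≤ ‖c‖ := by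
  refine ContinuousLinearMap.opNorm_le_bound _ (by positivity) fun x => ?_
  rw [matrixUnit_apply, norm_single]
  exact (norm_mul_le _ _).trans (by gcongr; exact norm_apply_le x j)

/-- The coordinate `x ↦ x n` as a continuous linear map. -/
noncomputable def coordCLM (n : ℕ) : StdModule A →L[ℂ] A :=
  LinearMap.mkContinuous
    { toFun := fun x => x n
      map_add' := fun _ _ => rfl
      map_smul' := fun _ _ => rfl } 1 fun x => (norm_apply_le x n).trans_eq (one_mul _).symm

@[simp] theorem coordCLM_apply (n : ℕ) (x : StdModule A) : coordCLM n x = x n := rfl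

theorem norm_sum_star_mul_self_le (x : StdModule A) (t : Finset ℕ) :
    ‖∑ n ∈ t, star (x n) * x n‖ ≤ ‖x‖ ^ 2 := by
  rw [norm_eq, Real.sq_sqrt (norm_nonneg _)]
  exact CStarAlgebra.norm_le_norm_of_nonneg_of_le
    (Finset.sum_nonneg fun i _ => star_mul_self_nonneg _)
    ((summable x x).sum_le_tsum t fun i _ => star_mul_self_nonneg _)

/-- The parallelogram law for `y` and `y - x`: the difference of the two sides, before taking norms,
is the sum of the squares of `y + (y - x)`. -/
theorem norm_sum_star_mul_self_le_two (x y : ℕ → A) (t : Finset ℕ) :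
    ‖∑ n ∈ t, star (x n) * x n‖ ≤
      2 * ‖∑ n ∈ t, star (y n - x n) * (y n - x n)‖ + 2 * ‖∑ n ∈ t, star (y n) * y n‖ := by
  have h : ∑ n ∈ t, star (x n) * x n ≤
      (∑ n ∈ t, star (y n - x n) * (y n - x n) + ∑ n ∈ t, star (y n - x n) * (y n - x n)) +
        (∑ n ∈ t, star (y n) * y n + ∑ n ∈ t, star (y n) * y n) := by
    simp only [← Finset.sum_add_distrib]
    refine Finset.sum_le_sum fun n _ => ?_
    have h0 := star_mul_self_nonneg (y n + (y n - x n))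
    rw [← sub_nonneg]
    refine h0.trans_eq ?_
    simp only [star_add, star_sub, add_mul, mul_add, sub_mul, mul_sub]
    abel
  refine (CStarAlgebra.norm_le_norm_of_nonneg_of_le
    (Finset.sum_nonneg fun i _ => star_mul_self_nonneg _) h).trans ?_
  refine (norm_add_le _ _).trans ?_
  rw [two_mul, two_mul]
  exact add_le_add (norm_add_le _ _) (norm_add_le _ _)

/-- Makes absolutely convergent series of operators on `H_A` and `H_B` converge. -/
instance : CompleteSpace (StdModule A) := by
  refine Metric.complete_of_cauchySeq_tendsto fun u hu => ?_
  have hc : ∀ n, ∃ a, Tendsto (fun k => u k n) atTop (𝓝 a) := fun n =>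
    cauchySeq_tendsto_of_complete
      (hu.map (coordCLM (A := A) n).uniformContinuous)
  choose x hx using hc
  have hle : ∀ ε > 0, ∃ N, ∀ k ≥ N, ∀ t : Finset ℕ,
      ‖∑ n ∈ t, star (u k n - x n) * (u k n - x n)‖ ≤ ε ^ 2 := fun ε hε => by
    obtain ⟨N, hN⟩ := Metric.cauchySeq_iff.1 hu ε hε
    refine ⟨N, fun k hk t => ?_⟩
    have hlim : Tendsto (fun l => ∑ n ∈ t, star (u k n - u l n) * (u k n - u l n)) atTop
        (𝓝 (∑ n ∈ t, star (u k n - x n) * (u k n - x n))) := by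
      refine tendsto_finsetSum _ fun n _ => ?_
      have := (tendsto_const_nhds (x := u k n)).sub (hx n)
      exact this.star.mul this
    refine le_of_tendsto hlim.norm ?_
    filter_upwards [eventually_ge_atTop N] with l hl
    have h1 := hN k hk l hl
    rw [dist_eq_norm] at h1
    refine (norm_sum_star_mul_self_le (u k - u l) t).trans ?_
    gcongr
  have hmem : Summable fun n => star (x n) * x n := by
    rw [summable_iff_vanishing_norm]
    intro ε hε
    obtain ⟨N, hN⟩ := hle (√(ε / 8)) (by positivity)
    obtain ⟨s, hs⟩ := summable_iff_vanishing_norm.1 (u N).2 (ε / 4) (by positivity)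
    refine ⟨s, fun t ht => ?_⟩
    have h1 := hN N le_rfl t
    have h2 := hs t ht
    rw [Real.sq_sqrt (by positivity)] at h1
    have h3 := norm_sum_star_mul_self_le_two x (u N) t
    linarith
  obtain ⟨z, hz⟩ : ∃ z : StdModule A, ∀ n, z n = x n := ⟨⟨x, hmem⟩, fun _ => rfl⟩
  simp only [← hz] at hle
  refine ⟨z, Metric.tendsto_atTop.2 fun ε hε => ?_⟩
  obtain ⟨N, hN⟩ := hle (ε / 2) (by positivity)
  refine ⟨N, fun k hk => ?_⟩
  rw [dist_eq_norm]
  refine lt_of_le_of_lt ?_ (half_lt_self hε)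
  rw [norm_eq]
  refine Real.sqrt_le_iff.2 ⟨by positivity, ?_⟩
  exact le_of_tendsto (summable (u k - z) (u k - z)).hasSum.norm
    (Eventually.of_forall fun t => hN k hk t)

theorem matrixOp_eq_sum (a : ℕ × ℕ →₀ A) :
    matrixOp a = a.sum fun p c => matrixUnitCLM p.1 p.2 c := rfl

theorem matrixOp_add (a b : ℕ × ℕ →₀ A) : matrixOp (a + b) = matrixOp a + matrixOp b := by
  simp only [matrixOp_eq_sum]
  exact Finsupp.sum_add_index' (fun _ => map_zero _) fun _ => map_add _

theorem matrixOp_smul (c : ℂ) (a : ℕ × ℕ →₀ A) : matrixOp (c • a) = c • matrixOp a := by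
  simp only [matrixOp_eq_sum]
  rw [Finsupp.sum_smul_index' fun _ => map_zero _, Finsupp.smul_sum]
  simp only [map_smul]

theorem matrixOp_single (p : ℕ × ℕ) (c : A) :
    matrixOp (Finsupp.single p c) = matrixUnit p.1 p.2 c := by
  rw [matrixOp_eq_sum]
  exact Finsupp.sum_single_index (map_zero _)

end StdModule

variable {A B : Type*} [NonUnitalCStarAlgebra A] [NonUnitalCStarAlgebra B]
  [PartialOrder A] [StarOrderedRing A] [PartialOrder B] [StarOrderedRing B]
  {𝒜 : NonUnitalStarSubalgebra ℂ A}

/-- The map `a ↦ (a, δ(a))` from finite matrices over `𝒜` to pairs of operators. -/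
noncomputable def matDerivOp (δ : 𝒜 →ₗ[ℂ] B) : (ℕ × ℕ →₀ 𝒜) →ₗ[ℂ]
    (StdModule A →L[ℂ] StdModule A) × (StdModule B →L[ℂ] StdModule B) where
  toFun a := (matOp a, derivOp δ a)
  map_add' a b := Prod.ext
    ((congrArg StdModule.matrixOp (Finsupp.mapRange_add (fun _ _ => rfl) a b)).trans
      (StdModule.matrixOp_add _ _))
    ((congrArg StdModule.matrixOp (Finsupp.mapRange_add (map_add δ) a b)).trans
      (StdModule.matrixOp_add _ _))
  map_smul' c a := Prod.ext
    ((congrArg StdModule.matrixOp (Finsupp.mapRange_smul c a fun _ => rfl)).trans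
      (StdModule.matrixOp_smul _ _))
    ((congrArg StdModule.matrixOp (Finsupp.mapRange_smul c a (map_smul δ c))).trans
      (StdModule.matrixOp_smul _ _))

/-- A sequence of pairs `(a_n, δ(a_n))` that converges in the product is Cauchy in both components,
hence Cauchy for `‖·‖_δ`. -/
theorem mem_diffCompactOps_of_mem_closure {δ : 𝒜 →ₗ[ℂ] B}
    {T : StdModule A →L[ℂ] StdModule A} {S : StdModule B →L[ℂ] StdModule B}
    (h : (T, S) ∈ (LinearMap.range (matDerivOp δ)).topologicalClosure) :
    T ∈ diffCompactOps δ := by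
  obtain ⟨u, hu, hlim⟩ := mem_closure_iff_seq_limit.1 h
  choose a ha using hu
  have h1 : Tendsto (fun n => matOp (a n)) atTop (𝓝 T) := by
    refine (continuous_fst.continuousAt.tendsto.comp hlim).congr fun n => ?_
    rw [Function.comp_apply, ← ha]; rfl
  refine ⟨a, fun ε hε => ?_, h1⟩
  obtain ⟨N, hN⟩ := Metric.cauchySeq_iff.1 hlim.cauchySeq (ε / 2) (by positivity)
  refine ⟨N, fun m hm n hn => ?_⟩
  have h2 := hN m hm n hn
  rw [dist_eq_norm, ← ha, ← ha, ← map_sub] at h2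
  have h3 := (norm_fst_le _).trans_lt h2
  have h4 := (norm_snd_le _).trans_lt h2
  change ‖matOp _‖ < _ at h3
  change ‖derivOp δ _‖ < _ at h4
  rw [deltaNorm]
  linarith

theorem matrixUnit_mem_closure {δ : 𝒜 →ₗ[ℂ] B} {a : A} {b : B} (h : (a, b) ∈ graphClosure δ)
    (i j : ℕ) : (StdModule.matrixUnit i j a, StdModule.matrixUnit i j b) ∈
      (LinearMap.range (matDerivOp δ)).topologicalClosure := by
  refine map_mem_closure (f := fun p : A × B =>
    (StdModule.matrixUnitCLM i j p.1, StdModule.matrixUnitCLM i j p.2)) (by fun_prop) h ?_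
  rintro _ ⟨c, rfl⟩
  refine ⟨Finsupp.single (i, j) c, Prod.ext ?_ ?_⟩
  · exact (congrArg StdModule.matrixOp Finsupp.mapRange_single).trans
      (StdModule.matrixOp_single _ _)
  · exact (congrArg StdModule.matrixOp Finsupp.mapRange_single).trans
      (StdModule.matrixOp_single _ _)

/-- An absolutely summable matrix with entries in the domain of the closure of `δ`, with absolutely
summable derivative, is a differentiable compact operator. -/
theorem mem_diffCompactOps_of_summable {δ : 𝒜 →ₗ[ℂ] B} {a : ℕ → ℕ → A} {b : ℕ → ℕ → B}
    (hab : ∀ m n, (a m n, b m n) ∈ graphClosure δ) {g : ℕ × ℕ → ℝ} (hg : Summable g)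
    (ha : ∀ p, ‖a p.1 p.2‖ ≤ g p) (hb : ∀ p, ‖b p.1 p.2‖ ≤ g p)
    {T : StdModule A →L[ℂ] StdModule A} (hT : ∀ x m, HasSum (fun n => a m n * x n) (T x m)) :
    T ∈ diffCompactOps δ := by
  have ha' : Summable fun p : ℕ × ℕ => StdModule.matrixUnit p.1 p.2 (a p.1 p.2) :=
    .of_norm_bounded hg fun p => (StdModule.norm_matrixUnit_le _ _ _).trans (ha p)
  have hb' : Summable fun p : ℕ × ℕ => StdModule.matrixUnit p.1 p.2 (b p.1 p.2) :=
    .of_norm_bounded hg fun p => (StdModule.norm_matrixUnit_le _ _ _).trans (hb p)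
  -- The series converges in operator norm; both operators are then compared coordinatewise, where
  -- only the row `m` contributes.
  have hTeq : T = ∑' p : ℕ × ℕ, StdModule.matrixUnit p.1 p.2 (a p.1 p.2) := by
    ext x m
    have h1 := ((StdModule.coordCLM m).comp
      (ContinuousLinearMap.apply ℂ (StdModule A) x)).hasSum ha'.hasSum
    simp only [ContinuousLinearMap.comp_apply, ContinuousLinearMap.apply_apply,
      StdModule.coordCLM_apply, StdModule.matrixUnit_apply, StdModule.single_apply] at h1
    have h2 := (Function.Injective.hasSum_iff (g := fun n : ℕ => (m, n))
      (fun _ _ h => (Prod.mk.inj h).2) (fun p hp => if_neg fun h => hp ⟨p.2, by rw [h]⟩)).2 h1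
    simp only [Function.comp_def, if_true] at h2
    exact (hT x m).unique h2
  rw [hTeq]
  refine mem_diffCompactOps_of_mem_closure
    ((Submodule.isClosed_topologicalClosure _).mem_of_tendsto (ha'.hasSum.prodMk hb'.hasSum)
      (Eventually.of_forall fun _ => sum_mem fun p _ => matrixUnit_mem_closure (hab _ _) _ _))

end MatrixOperators

/-- A family of vectors whose norms are dominated by small positive weights. -/
structure IsSmallFamily {X : Type*} [Norm X] (ξ : ℕ → X) (w : ℕ → ℝ) : Prop where
  pos : ∀ i, 0 < w i
  summable : Summable w
  summable_sq : Summable fun i => w i ^ 2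
  tsum_sq_lt : ∑' i, w i ^ 2 < 1
  norm_le : ∀ i, ‖ξ i‖ ≤ w i

/-! ### The operator `h`, its Cayley transform `r`, and the decay of `h^m r^k`. -/

section Gram

variable (A : Type*) {X : Type*} [NonUnitalCStarAlgebra A] [PartialOrder A] [StarOrderedRing A]
  [NormedAddCommGroup X] [NormedSpace ℂ X] [SMul Aᵐᵒᵖ X] [CStarModule Aᵐᵒᵖ X] (ξ : ℕ → X)

/-- The operator `x ↦ ∑ ξ_i ⟨ξ_i, x⟩`. -/
noncomputable def gram : X →L[ℂ] X := ∑' i, rankOne A (ξ i) (ξ i)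

/-- The inverse of `1 + gram A ξ`, as a Neumann series. -/
noncomputable def res : X →L[ℂ] X := ∑' n : ℕ, (-gram A ξ) ^ n

/-- The Cayley transform `(1 - h) / (1 + h)` of `h = gram A ξ`. -/
noncomputable def cay : X →L[ℂ] X := res A ξ + res A ξ - 1

namespace IsSmallFamily

variable {A} {ξ} {w : ℕ → ℝ} [CompleteSpace X] (hξ : IsSmallFamily ξ w)
include hξ

theorem norm_rankOne_le_sq (i : ℕ) : ‖rankOne A (ξ i) (ξ i)‖ ≤ w i ^ 2 := by
  refine (norm_rankOne_le _ _).trans ?_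
  rw [sq]
  exact mul_le_mul (hξ.norm_le i) (hξ.norm_le i) (norm_nonneg _) (hξ.pos i).le

theorem hasSum_gram : HasSum (fun i => rankOne A (ξ i) (ξ i)) (gram A ξ) :=
  (Summable.of_norm_bounded hξ.summable_sq hξ.norm_rankOne_le_sq).hasSum

theorem norm_gram_le : ‖gram A ξ‖ ≤ ∑' i, w i ^ 2 :=
  tsum_of_norm_bounded hξ.summable_sq.hasSum hξ.norm_rankOne_le_sq

theorem norm_neg_gram_lt : ‖-gram A ξ‖ < 1 := by
  rw [norm_neg]; exact hξ.norm_gram_le.trans_lt hξ.tsum_sq_lt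

theorem isAdjoint_gram : IsAdjoint A (gram A ξ) (gram A ξ) :=
  .hasSum (fun i => .rankOne (ξ i) (ξ i)) hξ.hasSum_gram hξ.hasSum_gram

theorem gram_mem_compactOps : gram A ξ ∈ compactOps A := by
  have h := hξ.hasSum_gram (A := A)
  rw [HasSum] at h
  rw [compactOps]
  refine mem_closure_of_tendsto h (Eventually.of_forall fun s => ?_)
  rw [SetLike.mem_coe]
  refine Submodule.sum_mem _ fun i _ => Submodule.subset_span ?_
  exact isRankOne_rankOne (ξ i) (ξ i)

theorem hasSum_gram_apply (x : X) : HasSum (fun i => ξ i <• rinner A (ξ i) x) (gram A ξ x) := by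
  have h := hξ.hasSum_gram (A := A)
  simpa only [ContinuousLinearMap.apply_apply, rankOne_apply] using
    (ContinuousLinearMap.apply ℂ X x).hasSum h

theorem hasSum_rinner_gram (x y : X) :
    HasSum (fun i => rinner A x (ξ i) * rinner A (ξ i) y) (rinner A x (gram A ξ y)) := by
  simpa only [rinnerCLM_apply, rinner_smul_right] using
    (rinnerCLM A x).hasSum (hξ.hasSum_gram_apply (A := A) y)

theorem rinner_mul_rinner_le (x : X) (i : ℕ) :
    rinner A x (ξ i) * rinner A (ξ i) x ≤ rinner A x (gram A ξ x) :=
  le_hasSum (hξ.hasSum_rinner_gram x x) i fun j _ => by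
    rw [← star_rinner (ξ j)]; exact star_mul_self_nonneg _

theorem rinner_gram_nonneg (x : X) : 0 ≤ rinner A x (gram A ξ x) :=
  (hξ.hasSum_rinner_gram x x).nonneg fun j => by
    rw [← star_rinner (ξ j)]; exact star_mul_self_nonneg _

theorem hasSum_res : HasSum (fun n : ℕ => (-gram A ξ) ^ n) (res A ξ) :=
  (summable_geometric_of_norm_lt_one hξ.norm_neg_gram_lt).hasSum

theorem gram_mul_res : gram A ξ * res A ξ = 1 - res A ξ := by
  have h := mul_neg_geom_series (-gram A ξ) hξ.norm_neg_gram_lt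
  rw [sub_neg_eq_add, add_mul, one_mul] at h
  rw [eq_sub_iff_add_eq, add_comm]; exact h

theorem res_mul_gram : res A ξ * gram A ξ = 1 - res A ξ := by
  have h := geom_series_mul_neg (-gram A ξ) hξ.norm_neg_gram_lt
  rw [sub_neg_eq_add, mul_add, mul_one] at h
  rw [eq_sub_iff_add_eq, add_comm]; exact h

theorem isAdjoint_res : IsAdjoint A (res A ξ) (res A ξ) := by
  refine .hasSum (fun n => IsAdjoint.pow ?_ n) hξ.hasSum_res hξ.hasSum_res
  simpa using hξ.isAdjoint_gram.smul (-1)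

theorem isAdjoint_cay : IsAdjoint A (cay A ξ) (cay A ξ) :=
  (hξ.isAdjoint_res.add hξ.isAdjoint_res).sub .one

theorem commute_gram_res : Commute (gram A ξ) (res A ξ) :=
  hξ.gram_mul_res.trans hξ.res_mul_gram.symm

theorem commute_res_cay : Commute (res A ξ) (cay A ξ) :=
  ((Commute.refl _).add_right (Commute.refl _)).sub_right (Commute.one_right _)

theorem commute_gram_cay : Commute (gram A ξ) (cay A ξ) :=
  (hξ.commute_gram_res.add_right hξ.commute_gram_res).sub_right (Commute.one_right _)

theorem one_sub_cay : 1 - cay A ξ = gram A ξ * (res A ξ + res A ξ) := by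
  rw [mul_add, hξ.gram_mul_res, cay]; abel

/-- The identity `1 - r² = q h q` with `q = 2 (1 + h)⁻¹`. It makes `r` a contraction and lets the
sums over `r^k` telescope. -/
theorem one_sub_cay_mul_cay :
    1 - cay A ξ * cay A ξ = (res A ξ + res A ξ) * (gram A ξ * (res A ξ + res A ξ)) := by
  rw [mul_add, hξ.gram_mul_res, cay]; noncomm_ring

theorem rinner_sub_rinner_cay (x : X) :
    rinner A x x - rinner A (cay A ξ x) (cay A ξ x) =
      rinner A ((res A ξ + res A ξ) x) (gram A ξ ((res A ξ + res A ξ) x)) := by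
  rw [hξ.isAdjoint_cay, ← rinner_sub_right, hξ.isAdjoint_res.add hξ.isAdjoint_res]
  exact congrArg (rinner A x) (DFunLike.congr_fun hξ.one_sub_cay_mul_cay x)

theorem rinner_cay_le (x : X) : rinner A (cay A ξ x) (cay A ξ x) ≤ rinner A x x := by
  rw [← sub_nonneg, hξ.rinner_sub_rinner_cay]
  exact hξ.rinner_gram_nonneg _

theorem norm_cay_apply_le (x : X) : ‖cay A ξ x‖ ≤ ‖x‖ := norm_le_of_rinner_le (hξ.rinner_cay_le x)

theorem norm_cay_pow_le (n : ℕ) : ‖cay A ξ ^ n‖ ≤ 1 := by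
  refine ContinuousLinearMap.opNorm_le_bound _ zero_le_one fun x => ?_
  rw [one_mul]
  induction n with
  | zero => simp
  | succ n ih => rw [pow_succ']; exact (hξ.norm_cay_apply_le _).trans ih

theorem sum_rinner_gram (x : X) (N : ℕ) :
    ∑ k ∈ Finset.range N, rinner A ((res A ξ + res A ξ) ((cay A ξ ^ k) x))
      (gram A ξ ((res A ξ + res A ξ) ((cay A ξ ^ k) x))) =
    rinner A x x - rinner A ((cay A ξ ^ N) x) ((cay A ξ ^ N) x) := by
  simp only [← hξ.rinner_sub_rinner_cay]
  have h := Finset.sum_range_sub' (fun k => rinner A ((cay A ξ ^ k) x) ((cay A ξ ^ k) x)) N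
  simp only [pow_succ', mul_apply_eq_comp] at h ⊢
  simpa using h

/-- With `z = r^k x`, consecutive terms are `⟨z, z⟩ - ⟨r z, r z⟩` and `⟨r z, r z⟩ - ⟨r² z, r² z⟩`.
Their difference is `⟨z - r² z, z - r² z⟩ ≥ 0`. -/
theorem antitone_rinner_gram (x : X) :
    Antitone fun k : ℕ => rinner A ((res A ξ + res A ξ) ((cay A ξ ^ k) x))
      (gram A ξ ((res A ξ + res A ξ) ((cay A ξ ^ k) x))) := by
  refine antitone_nat_of_succ_le fun k => ?_
  simp only [← hξ.rinner_sub_rinner_cay, pow_succ', mul_apply_eq_comp]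
  set z := (cay A ξ ^ k) x
  set r := cay A ξ
  have hr : IsAdjoint A r r := hξ.isAdjoint_cay
  have h := rinner_self_nonneg (A := A) (z - r (r z))
  rw [← sub_nonneg]
  refine h.trans_eq ?_
  have h1 : rinner A (r (r z)) z = rinner A (r z) (r z) := hr (r z) z
  have h2 : rinner A z (r (r z)) = rinner A (r z) (r z) := (hr z (r z)).symm
  rw [rinner_sub_right, ← star_rinner z, ← star_rinner (r (r z)), rinner_sub_right,
    rinner_sub_right, star_sub, star_sub]
  simp only [star_rinner, h1, h2]

/-- The terms `⟨q r^j x, h q r^j x⟩` decrease in `j` and telescope to at most `⟨x, x⟩`, so `k + 1`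
times the term with index `k` is at most `⟨x, x⟩`. That term dominates the contribution of the
single vector `ξ_i` to `h`. This replaces a spectral estimate. -/
theorem norm_rinner_res_cay_pow_sq_le (x : X) (i k : ℕ) :
    ‖rinner A (ξ i) ((res A ξ + res A ξ) ((cay A ξ ^ k) x))‖ ^ 2 * (k + 1) ≤ ‖x‖ ^ 2 := by
  set y := (res A ξ + res A ξ) ((cay A ξ ^ k) x) with hy
  have h1 : (k + 1) • (star (rinner A (ξ i) y) * rinner A (ξ i) y) ≤ rinner A x x := by
    calc (k + 1) • (star (rinner A (ξ i) y) * rinner A (ξ i) y)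
        ≤ (k + 1) • rinner A y (gram A ξ y) := by
          refine nsmul_le_nsmul_right ?_ _
          rw [star_rinner]
          exact hξ.rinner_mul_rinner_le y i
      _ ≤ _ := by
          have h := Finset.card_nsmul_le_sum (Finset.range (k + 1)) _ _ fun j hj =>
            hξ.antitone_rinner_gram (A := A) x (Nat.lt_succ_iff.1 (Finset.mem_range.1 hj))
          rw [Finset.card_range] at h
          exact h
      _ = rinner A x x - rinner A ((cay A ξ ^ (k + 1)) x) ((cay A ξ ^ (k + 1)) x) :=
          hξ.sum_rinner_gram x (k + 1)
      _ ≤ rinner A x x := sub_le_self _ (rinner_self_nonneg _)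
  have h2 := CStarAlgebra.norm_le_norm_of_nonneg_of_le
    (nsmul_nonneg (star_mul_self_nonneg _) _) h1
  rw [← norm_sq_eq_rinner, ← Nat.cast_smul_eq_nsmul ℝ, norm_smul,
    CStarRing.norm_star_mul_self] at h2
  rw [sq, mul_comm]
  simpa [abs_of_nonneg (show (0 : ℝ) ≤ k + 1 by positivity)] using h2

theorem norm_rinner_cay_pow_sq_le (x : X) (i k : ℕ) :
    ‖rinner A (ξ i) ((cay A ξ ^ k) x)‖ ^ 2 * (k + 1) ≤ ‖x‖ ^ 2 := by
  -- The factor `q` is removed by applying the previous bound to `x' = q⁻¹ x`, whose norm is at most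
  -- `‖x‖` because `‖h‖ ≤ 1`.
  set x' := (2 : ℂ)⁻¹ • (x + gram A ξ x) with hx'
  have h1 : (res A ξ + res A ξ) x' = x := by
    have h2 : (res A ξ + res A ξ) * (1 + gram A ξ) = 2 := by
      rw [mul_add, mul_one, add_mul, hξ.res_mul_gram, ← one_add_one_eq_two]; abel
    have h3 : (res A ξ + res A ξ) (x + gram A ξ x) = (2 : ℂ) • x := by
      rw [two_smul]
      have := DFunLike.congr_fun h2 x
      rw [← one_add_one_eq_two] at this
      exact this
    rw [hx', map_smul, h3, smul_smul, inv_mul_cancel₀ two_ne_zero, one_smul]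
  have h2 : (res A ξ + res A ξ) ((cay A ξ ^ k) x') = (cay A ξ ^ k) x := by
    conv_rhs => rw [← h1]
    exact DFunLike.congr_fun
      ((hξ.commute_res_cay (A := A).add_left hξ.commute_res_cay).pow_right k).eq x'
  have h3 : ‖x'‖ ≤ ‖x‖ := by
    rw [hx', norm_smul, norm_inv, Complex.norm_ofNat, inv_mul_le_iff₀ two_pos, two_mul]
    refine (norm_add_le _ _).trans (add_le_add le_rfl ?_)
    refine ((gram A ξ).le_opNorm x).trans (mul_le_of_le_one_left (norm_nonneg _) ?_)
    exact (hξ.norm_gram_le.trans_lt hξ.tsum_sq_lt).le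
  have h4 := hξ.norm_rinner_res_cay_pow_sq_le (A := A) x' i k
  rw [h2] at h4
  exact h4.trans (by gcongr)

/-- Taking `x = r^k ξ_i` in the previous estimate turns `⟨ξ_i, r^k x⟩` into `⟨x, x⟩`, so `‖x‖⁴ (k +
1) ≤ ‖x‖²`. -/
theorem norm_cay_pow_apply_sq_le (i k : ℕ) : ‖(cay A ξ ^ k) (ξ i)‖ ^ 2 * (k + 1) ≤ 1 := by
  have h := hξ.norm_rinner_cay_pow_sq_le (A := A) ((cay A ξ ^ k) (ξ i)) i k
  rw [← hξ.isAdjoint_cay.pow k, ← norm_sq_eq_rinner] at h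
  rcases (norm_nonneg ((cay A ξ ^ k) (ξ i))).eq_or_lt with h0 | h0
  · rw [← h0]; simp
  · refine le_of_mul_le_mul_left ?_ (pow_pos h0 2)
    linarith

/-- Expand `h r^k x = ∑ ξ_i ⟨ξ_i, r^k x⟩`; each coefficient is at most `‖x‖ / √(k + 1)`, and the
weights are summable. -/
theorem norm_gram_mul_cay_pow_sq_le (k : ℕ) :
    ‖gram A ξ * cay A ξ ^ k‖ ^ 2 * (k + 1) ≤ (∑' i, w i) ^ 2 := by
  have hk : (0 : ℝ) < k + 1 := by positivity
  have h0 : 0 ≤ ∑' i, w i := tsum_nonneg fun i => (hξ.pos i).le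
  have h : ‖gram A ξ * cay A ξ ^ k‖ ≤ (∑' i, w i) / √(k + 1) := by
    refine ContinuousLinearMap.opNorm_le_bound _ (by positivity) fun x => ?_
    rw [div_mul_eq_mul_div, mul_div_assoc]
    refine (hξ.hasSum_gram_apply (A := A) ((cay A ξ ^ k) x)).norm_le_of_bounded
      (hξ.summable.hasSum.mul_right (‖x‖ / √(k + 1))) fun i => ?_
    refine (norm_op_smul_le _ _).trans
      (mul_le_mul (hξ.norm_le i) ?_ (norm_nonneg _) (hξ.pos i).le)
    refine le_of_sq_le_sq ?_ (by positivity)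
    rw [div_pow, Real.sq_sqrt hk.le, le_div_iff₀ hk]
    exact hξ.norm_rinner_cay_pow_sq_le x i k
  calc _ ≤ ((∑' i, w i) / √(k + 1)) ^ 2 * (k + 1) := by gcongr
    _ = _ := by rw [div_pow, Real.sq_sqrt hk.le, div_mul_cancel₀ _ hk.ne']

/-- Splitting `h^(2m) r^k` into `h^m r^(k/2)` times `h^m r^(k - k/2)` doubles both the power of `h`
and the rate of decay. Four doublings of the rate `1/2` for `h r^k` give the rate 8 for `h^16 r^k`.
-/
theorem exists_norm_gram_pow_mul_cay_pow_le :
    ∃ C, ∀ k : ℕ, ‖gram A ξ ^ 16 * cay A ξ ^ k‖ * (k + 1) ^ 8 ≤ C := by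
  have double : ∀ m p : ℕ,
      (∃ C, ∀ k : ℕ, ‖gram A ξ ^ m * cay A ξ ^ k‖ ^ 2 * (k + 1) ^ p ≤ C) →
      ∃ C, ∀ k : ℕ, ‖gram A ξ ^ (2 * m) * cay A ξ ^ k‖ ^ 2 * (k + 1) ^ (2 * p) ≤ C := by
    rintro m p ⟨C, hC⟩
    have hC0 : 0 ≤ C := le_trans (by positivity) (hC 0)
    refine ⟨(2 ^ p * C) ^ 2, fun k => ?_⟩
    have h1 : gram A ξ ^ (2 * m) * cay A ξ ^ k =
        (gram A ξ ^ m * cay A ξ ^ (k / 2)) * (gram A ξ ^ m * cay A ξ ^ (k - k / 2)) := by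
      rw [mul_assoc, ← mul_assoc (cay A ξ ^ _), ((hξ.commute_gram_cay.pow_pow m (k / 2)).eq).symm,
        mul_assoc, ← pow_add, ← mul_assoc, ← pow_add, two_mul,
        Nat.add_sub_cancel' (Nat.div_le_self k 2)]
    have key : ∀ l : ℕ, k + 1 ≤ 2 * (l + 1) →
        ‖gram A ξ ^ m * cay A ξ ^ l‖ ^ 2 * (k + 1) ^ p ≤ 2 ^ p * C := fun l hl => by
      have hl' : (k : ℝ) + 1 ≤ 2 * (l + 1) := by exact_mod_cast hl
      calc _ ≤ ‖gram A ξ ^ m * cay A ξ ^ l‖ ^ 2 * (2 * (l + 1)) ^ p := by gcongr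
        _ = 2 ^ p * (‖gram A ξ ^ m * cay A ξ ^ l‖ ^ 2 * (l + 1) ^ p) := by rw [mul_pow]; ring
        _ ≤ _ := by gcongr; exact hC l
    rw [h1]
    calc _ ≤ (‖gram A ξ ^ m * cay A ξ ^ (k / 2)‖ * ‖gram A ξ ^ m * cay A ξ ^ (k - k / 2)‖) ^ 2 *
          (k + 1) ^ (2 * p) := by gcongr; exact norm_mul_le _ _
      _ = (‖gram A ξ ^ m * cay A ξ ^ (k / 2)‖ ^ 2 * (k + 1) ^ p) *
          (‖gram A ξ ^ m * cay A ξ ^ (k - k / 2)‖ ^ 2 * (k + 1) ^ p) := by ring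
      _ ≤ _ := by
          rw [sq (2 ^ p * C)]
          exact mul_le_mul (key _ (by omega)) (key _ (by omega)) (by positivity) (by positivity)
  obtain ⟨C, hC⟩ := double 8 8 <| double 4 4 <| double 2 2 <| double 1 1
    ⟨_, fun k => by simpa using hξ.norm_gram_mul_cay_pow_sq_le (A := A) k⟩
  refine ⟨√C, fun k => Real.le_sqrt_of_sq_le ?_⟩
  rw [mul_pow, ← pow_mul]
  exact hC k

/-! ### Consequences of density: strong convergence `r^k → 0` and the Parseval frame. -/

section Dense

variable (hd : Dense (rightSpan A ξ))
include hd

/-- The decay on each `ξ_i` extends to finite sums `∑ ξ_i a_i` since `r^k` is a module map, and to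
all of `X` since the `r^k` are contractions. -/
theorem tendsto_cay_pow (x : X) : Tendsto (fun k => (cay A ξ ^ k) x) atTop (𝓝 0) := by
  have h1 : ∀ i, Tendsto (fun k => (cay A ξ ^ k) (ξ i)) atTop (𝓝 0) := fun i => by
    have h2 : Tendsto (fun k => ‖(cay A ξ ^ k) (ξ i)‖ ^ 2) atTop (𝓝 0) := by
      refine squeeze_zero (fun _ => by positivity) (fun k => ?_)
        tendsto_one_div_add_atTop_nhds_zero_nat
      rw [le_div_iff₀ (by positivity)]
      exact hξ.norm_cay_pow_apply_sq_le i k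
    rw [tendsto_zero_iff_norm_tendsto_zero]
    simpa using h2.sqrt
  have h2 : ∀ y ∈ rightSpan A ξ, Tendsto (fun k => (cay A ξ ^ k) y) atTop (𝓝 0) := by
    rintro _ ⟨N, a, rfl⟩
    simp only [map_sum, (hξ.isAdjoint_cay.pow _).map_op_smul]
    rw [← Finset.sum_const_zero (s := Finset.range N)]
    refine tendsto_finsetSum _ fun i _ => ?_
    have h3 : Tendsto (fun k => ‖(cay A ξ ^ k) (ξ i)‖ * ‖a i‖) atTop (𝓝 0) := by
      simpa using (h1 i).norm.mul_const ‖a i‖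
    exact squeeze_zero_norm (fun k => norm_op_smul_le _ _) h3
  refine Metric.tendsto_atTop.2 fun ε hε => ?_
  obtain ⟨y, hy, hxy⟩ := Metric.dense_iff.1 hd x (ε / 2) (by positivity)
  obtain ⟨N, hN⟩ := Metric.tendsto_atTop.1 (h2 _ hxy) (ε / 2) (by positivity)
  refine ⟨N, fun k hk => ?_⟩
  have h4 := hN k hk
  rw [Metric.mem_ball, dist_eq_norm, norm_sub_rev] at hy
  rw [dist_zero_right] at h4 ⊢
  have h5 : ‖(cay A ξ ^ k) (x - y)‖ ≤ ‖x - y‖ :=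
    ((cay A ξ ^ k).le_opNorm _).trans
      (mul_le_of_le_one_left (norm_nonneg _) (hξ.norm_cay_pow_le k))
  calc ‖(cay A ξ ^ k) x‖ = ‖(cay A ξ ^ k) (x - y) + (cay A ξ ^ k) y‖ := by
        rw [← map_add, sub_add_cancel]
    _ ≤ _ := norm_add_le _ _
    _ < ε := by linarith

/-- Since `1 - r = h q`, the operator `1 - r^k = (1 - r) ∑_{a < k} r^a` has range in that of `h`,
and `x - r^k x → x`. -/
theorem denseRange_gram_pow (n : ℕ) : DenseRange (gram A ξ ^ n) := by
  have h : DenseRange (gram A ξ) := fun x => by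
    have h1 : Tendsto (fun k => x - (cay A ξ ^ k) x) atTop (𝓝 x) := by
      simpa using tendsto_const_nhds.sub (hξ.tendsto_cay_pow hd x)
    refine mem_closure_of_tendsto h1 (Eventually.of_forall fun k => ?_)
    have h2 := mul_neg_geom_sum (cay A ξ) k
    rw [hξ.one_sub_cay, mul_assoc] at h2
    exact ⟨_, DFunLike.congr_fun h2 x⟩
  induction n with
  | zero => exact Function.surjective_id.denseRange
  | succ n ih => rw [pow_succ']; exact h.comp ih (gram A ξ).continuous

/-- The vectors `2 (1 + h)⁻¹ r ^ k ξ_i`, with `h = gram A ξ` and `r` its Cayley transform, form a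
Parseval frame. -/
theorem isParsevalFrame : IsParsevalFrame A fun n =>
    (res A ξ + res A ξ) ((cay A ξ ^ n.unpair.1) (ξ n.unpair.2)) := fun x => by
  set y : ℕ → X := fun k => (res A ξ + res A ξ) ((cay A ξ ^ k) x) with hy
  have hη : ∀ k i, rinner A ((res A ξ + res A ξ) ((cay A ξ ^ k) (ξ i))) x =
      rinner A (ξ i) (y k) := fun k i => by
    rw [hξ.isAdjoint_res.add hξ.isAdjoint_res, hξ.isAdjoint_cay.pow k]
    exact congrArg _ (DFunLike.congr_fun
      ((hξ.commute_res_cay (A := A).add_left hξ.commute_res_cay).pow_right k).eq x).symm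
  suffices h : HasSum (fun p : ℕ × ℕ => rinner A (y p.1) (ξ p.2) * rinner A (ξ p.2) (y p.1))
      (rinner A x x) by
    refine (Nat.pairEquiv.symm.hasSum_iff.2 h).congr_fun fun n => ?_
    rw [hη, ← star_rinner _ x, hη, star_rinner]
    rfl
  have hpos : ∀ p : ℕ × ℕ, 0 ≤ rinner A (y p.1) (ξ p.2) * rinner A (ξ p.2) (y p.1) := fun p => by
    rw [← star_rinner (ξ p.2)]; exact star_mul_self_nonneg _
  refine hasSum_of_sum_le_of_forall_exists hpos (fun s => ?_) fun ε hε => ?_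
  -- Upper bound: enlarge `s` to a rectangle, sum over `i` to at most `⟨y_k, h y_k⟩`, then telescope
  -- over `k`.
  · obtain ⟨N, hN⟩ := (s.image Prod.fst).exists_nat_subset_range
    have hsub : s ⊆ Finset.range N ×ˢ s.image Prod.snd := fun p hp =>
      Finset.mem_product.2 ⟨hN (Finset.mem_image_of_mem _ hp), Finset.mem_image_of_mem _ hp⟩
    calc _ ≤ ∑ p ∈ Finset.range N ×ˢ s.image Prod.snd,
            rinner A (y p.1) (ξ p.2) * rinner A (ξ p.2) (y p.1) :=
          Finset.sum_le_sum_of_subset_of_nonneg hsub fun p _ _ => hpos p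
      _ ≤ ∑ k ∈ Finset.range N, rinner A (y k) (gram A ξ (y k)) := by
          rw [Finset.sum_product]
          exact Finset.sum_le_sum fun k _ => sum_le_hasSum _ (fun i _ => hpos (k, i))
            (hξ.hasSum_rinner_gram (y k) (y k))
      _ = _ := hξ.sum_rinner_gram x N
      _ ≤ _ := sub_le_self _ (rinner_self_nonneg _)
  -- Approximation: the telescoped remainder is `⟨r^N x, r^N x⟩ → 0`. Once `N` is fixed, one finite
  -- set `t` of indices `i` serves all `k < N`.
  · have h1 : Tendsto (fun N => rinner A x x -
        ∑ k ∈ Finset.range N, rinner A (y k) (gram A ξ (y k))) atTop (𝓝 0) := by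
      simp only [hy, hξ.sum_rinner_gram x, sub_sub_cancel]
      rw [tendsto_zero_iff_norm_tendsto_zero]
      simp only [← norm_sq_eq_rinner]
      simpa using (hξ.tendsto_cay_pow hd x).norm.pow 2
    obtain ⟨N, hN⟩ := (Metric.tendsto_atTop.1 h1) (ε / 2) (by positivity)
    have h2 := hN N le_rfl
    have h3 := hasSum_sum (s := Finset.range N) fun k _ => hξ.hasSum_rinner_gram (A := A) (y k) (y k)
    obtain ⟨t, ht⟩ := (Metric.tendsto_nhds.1 h3 (ε / 2) (by positivity)).exists
    refine ⟨Finset.range N ×ˢ t, ?_⟩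
    rw [Finset.sum_product_right]
    rw [dist_zero_right] at h2
    rw [dist_eq_norm, norm_sub_rev] at ht
    calc _ = ‖(rinner A x x - ∑ k ∈ Finset.range N, rinner A (y k) (gram A ξ (y k))) +
          (∑ k ∈ Finset.range N, rinner A (y k) (gram A ξ (y k)) -
            ∑ i ∈ t, ∑ k ∈ Finset.range N, rinner A (y k) (ξ i) * rinner A (ξ i) (y k))‖ := by
          rw [sub_add_sub_cancel]
      _ ≤ _ := norm_add_le _ _
      _ < ε := by linarith

end Dense

end IsSmallFamily

end Gram

/-! ### Infinite matrices with entries bounded by multiples of `w_i w_j`. -/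

section WeightedMatrices

variable {B : Type*} [NonUnitalCStarAlgebra B]

/-- The entries of the infinite matrix `D` are bounded by `M w_i w_j`. -/
def WeightBound (w : ℕ → ℝ) (D : ℕ → ℕ → B) (M : ℝ) : Prop :=
  ∀ i j, ‖D i j‖ ≤ M * (w i * w j)

/-- The product of infinite matrices. -/
noncomputable def matMul (D E : ℕ → ℕ → B) (i j : ℕ) : B := ∑' m, D i m * E m j

variable {w : ℕ → ℝ}

theorem WeightBound.mono {D : ℕ → ℕ → B} {M M' : ℝ} (h : WeightBound w D M) (hw : ∀ i, 0 < w i)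
    (hM : M ≤ M') : WeightBound w D M' := fun i j =>
  (h i j).trans (mul_le_mul_of_nonneg_right hM (mul_pos (hw i) (hw j)).le)

theorem WeightBound.nonneg {D : ℕ → ℕ → B} {M : ℝ} (h : WeightBound w D M) (hw : ∀ i, 0 < w i) :
    0 ≤ M :=
  nonneg_of_mul_nonneg_left ((norm_nonneg _).trans (h 0 0)) (mul_pos (hw 0) (hw 0))

theorem WeightBound.add {D E : ℕ → ℕ → B} {M M' : ℝ} (h : WeightBound w D M)
    (h' : WeightBound w E M') : WeightBound w (D + E) (M + M') := fun i j => by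
  rw [add_mul]; exact (norm_add_le _ _).trans (add_le_add (h i j) (h' i j))

theorem WeightBound.sub {D E : ℕ → ℕ → B} {M M' : ℝ} (h : WeightBound w D M)
    (h' : WeightBound w E M') : WeightBound w (D - E) (M + M') := fun i j => by
  rw [add_mul]; exact (norm_sub_le _ _).trans (add_le_add (h i j) (h' i j))

theorem WeightBound.neg {D : ℕ → ℕ → B} {M : ℝ} (h : WeightBound w D M) :
    WeightBound w (-D) M := fun i j => (norm_neg _).trans_le (h i j)

variable {D E F : ℕ → ℕ → B} {M M' M'' : ℝ}

theorem WeightBound.norm_mul_le (h : WeightBound w D M) (h' : WeightBound w E M') (i m n j : ℕ) :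
    ‖D i m * E n j‖ ≤ M * M' * (w i * w j) * (w m * w n) :=
  (_root_.norm_mul_le _ _).trans <| (mul_le_mul (h i m) (h' n j) (norm_nonneg _)
    ((norm_nonneg _).trans (h i m))).trans_eq (by ring)

theorem WeightBound.summable_mul (h : WeightBound w D M) (h' : WeightBound w E M')
    (hs : Summable fun i => w i ^ 2) (i j : ℕ) :
    Summable fun m => D i m * E m j :=
  .of_norm_bounded (hs.mul_left (M * M' * (w i * w j))) fun m => by
    simpa only [sq] using h.norm_mul_le h' i m m j

theorem WeightBound.matMul (h : WeightBound w D M) (h' : WeightBound w E M')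
    (hs : Summable fun i => w i ^ 2) :
    WeightBound w (matMul D E) (M * M' * ∑' i, w i ^ 2) := fun i j => by
  refine (tsum_of_norm_bounded (hs.hasSum.mul_left (M * M' * (w i * w j))) fun m => ?_).trans_eq
    (by ring)
  simpa only [sq] using h.norm_mul_le h' i m m j

theorem matMul_sub_left (h : WeightBound w D M) (h' : WeightBound w E M')
    (h'' : WeightBound w F M'') (hs : Summable fun i => w i ^ 2) :
    matMul (D - E) F = matMul D F - matMul E F := by
  ext i j
  refine Eq.trans ?_ ((h.summable_mul h'' hs i j).tsum_sub (h'.summable_mul h'' hs i j))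
  exact tsum_congr fun m => sub_mul _ _ _

theorem matMul_sub_right (h : WeightBound w D M) (h' : WeightBound w E M')
    (h'' : WeightBound w F M'') (hs : Summable fun i => w i ^ 2) :
    matMul D (E - F) = matMul D E - matMul D F := by
  ext i j
  refine Eq.trans ?_ ((h.summable_mul h' hs i j).tsum_sub (h.summable_mul h'' hs i j))
  exact tsum_congr fun m => mul_sub _ _ _

/-- The double series is absolutely summable, its terms being dominated by a multiple of `w_n²
w_m²`. -/
theorem matMul_assoc (h : WeightBound w D M) (h' : WeightBound w E M')
    (h'' : WeightBound w F M'') (hs : Summable fun i => w i ^ 2) :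
    matMul (matMul D E) F = matMul D (matMul E F) := by
  ext i j
  have h1 : ∀ m, matMul D E i m * F m j = ∑' n, D i n * E n m * F m j := fun m =>
    ((h.summable_mul h' hs i m).tsum_mul_right _).symm
  have h2 : ∀ n, D i n * matMul E F n j = ∑' m, D i n * E n m * F m j := fun n => by
    simp only [mul_assoc]
    exact ((h'.summable_mul h'' hs n j).tsum_mul_left _).symm
  change ∑' m, matMul D E i m * F m j = ∑' n, D i n * matMul E F n j
  simp only [h1, h2]
  refine Summable.tsum_comm (.of_norm_bounded
    ((hs.mul_of_nonneg hs (fun _ => by positivity) fun _ => by positivity).mul_left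
      (M * M' * M'' * (w i * w j))) fun p => ?_)
  obtain ⟨n, m⟩ := p
  refine (_root_.norm_mul_le _ _).trans ?_
  refine (mul_le_mul (h.norm_mul_le h' i n n m) (h'' m j) (norm_nonneg _)
    ((norm_nonneg _).trans (h.norm_mul_le h' i n n m))).trans_eq ?_
  ring

end WeightedMatrices

/-! ### Derivatives of the matrices `(⟨ξ_i, Q ξ_j⟩)` and their growth. -/

section Derivatives

variable {A B X : Type*} [NonUnitalCStarAlgebra A] [PartialOrder A] [StarOrderedRing A]
  [NonUnitalCStarAlgebra B]
  [NormedAddCommGroup X] [NormedSpace ℂ X] [SMul Aᵐᵒᵖ X] [CStarModule Aᵐᵒᵖ X]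
  {𝒜 : NonUnitalStarSubalgebra ℂ A}

/-- The matrix `(ρ ⟨ξ_i, Q ξ_j⟩)`. -/
noncomputable def coeffMat (ρ : A →⋆ₙₐ[ℂ] B) (ξ : ℕ → X) (Q : X →L[ℂ] X) (i j : ℕ) : B :=
  ρ (rinner A (ξ i) (Q (ξ j)))

/-- The matrix `D` is the derivative, by the closure of `δ`, of the matrix `(⟨ξ_i, Q ξ_j⟩)`. -/
def IsMatDeriv (δ : 𝒜 →ₗ[ℂ] B) (ξ : ℕ → X) (Q : X →L[ℂ] X) (D : ℕ → ℕ → B) : Prop :=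
  ∀ i j, (rinner A (ξ i) (Q (ξ j)), D i j) ∈ graphClosure δ

/-- The matrix `(⟨ξ_i, Q ξ_j⟩)` has a derivative with entries bounded by `M w_i w_j`. -/
def HasDerivBound (δ : 𝒜 →ₗ[ℂ] B) (ξ : ℕ → X) (w : ℕ → ℝ) (Q : X →L[ℂ] X) (M : ℝ) : Prop :=
  ∃ D, IsMatDeriv δ ξ Q D ∧ WeightBound w D M

variable {ρ : A →⋆ₙₐ[ℂ] B} {δ : 𝒜 →ₗ[ℂ] B} {ξ : ℕ → X} {w : ℕ → ℝ}
  {Q Q' : X →L[ℂ] X} {D D' : ℕ → ℕ → B} {M M' : ℝ}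

theorem coeffMat_sub : coeffMat ρ ξ (Q - Q') = coeffMat ρ ξ Q - coeffMat ρ ξ Q' := by
  ext i j
  simp only [coeffMat, _root_.sub_apply, rinner_sub_right, map_sub, Pi.sub_apply]

theorem IsMatDeriv.add (h : IsMatDeriv δ ξ Q D) (h' : IsMatDeriv δ ξ Q' D') :
    IsMatDeriv δ ξ (Q + Q') (D + D') := fun i j => by
  rw [_root_.add_apply, rinner_add_right]
  exact add_mem (h i j) (h' i j)

theorem IsMatDeriv.sub (h : IsMatDeriv δ ξ Q D) (h' : IsMatDeriv δ ξ Q' D') :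
    IsMatDeriv δ ξ (Q - Q') (D - D') := fun i j => by
  rw [_root_.sub_apply, rinner_sub_right]
  exact sub_mem (h i j) (h' i j)

theorem IsMatDeriv.neg (h : IsMatDeriv δ ξ Q D) : IsMatDeriv δ ξ (-Q) (-D) := fun i j => by
  have := neg_mem (h i j)
  rwa [Prod.neg_mk, ← rinnerCLM_apply, ← map_neg] at this

namespace IsSmallFamily

variable [CompleteSpace X] (hξ : IsSmallFamily ξ w)
include hξ

theorem norm_rinner_apply_le (Q : X →L[ℂ] X) (i j : ℕ) :
    ‖rinner A (ξ i) (Q (ξ j))‖ ≤ ‖Q‖ * (w i * w j) := by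
  calc _ ≤ ‖ξ i‖ * (‖Q‖ * ‖ξ j‖) :=
        (norm_rinner_le _ _).trans (by gcongr; exact Q.le_opNorm _)
    _ ≤ w i * (‖Q‖ * w j) := by
        have := (hξ.pos i).le
        gcongr <;> exact hξ.norm_le _
    _ = _ := by ring

theorem weightBound_coeffMat (Q : X →L[ℂ] X) : WeightBound w (coeffMat ρ ξ Q) ‖Q‖ := fun i j =>
  (NonUnitalStarAlgHom.norm_apply_le ρ _).trans (hξ.norm_rinner_apply_le Q i j)

/-- The factor `h` between `Q` and `Q'` supplies the sum over `m`, so matrix products correspond to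
`Q h Q'`. This is why a spare `h` must separate the factors whenever the Leibniz rule is applied. -/
theorem hasSum_rinner_mul_rinner {Q S : X →L[ℂ] X} (hQ : IsAdjoint A Q S) (Q' : X →L[ℂ] X)
    (i j : ℕ) : HasSum (fun m => rinner A (ξ i) (Q (ξ m)) * rinner A (ξ m) (Q' (ξ j)))
      (rinner A (ξ i) ((Q * gram A ξ * Q') (ξ j))) := by
  have h := hξ.hasSum_rinner_gram (A := A) (S (ξ i)) (Q' (ξ j))
  simp only [hQ.symm (ξ i)] at h
  exact h

theorem coeffMat_mul {S : X →L[ℂ] X} (hQ : IsAdjoint A Q S) :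
    coeffMat ρ ξ (Q * gram A ξ * Q') = matMul (coeffMat ρ ξ Q) (coeffMat ρ ξ Q') := by
  have hρ : Continuous ρ :=
    AddMonoidHomClass.continuous_of_bound ρ 1 fun a => by
      simpa using NonUnitalStarAlgHom.norm_apply_le ρ a
  ext i j
  have h := (hξ.hasSum_rinner_mul_rinner hQ Q' i j).map ρ hρ
  simp only [Function.comp_def, map_mul] at h
  exact h.tsum_eq.symm

theorem isMatDeriv_mul (hδ : IsClosedDerivation ρ δ) {S : X →L[ℂ] X} (hQ : IsAdjoint A Q S)
    (h : IsMatDeriv δ ξ Q D) (hD : WeightBound w D M)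
    (h' : IsMatDeriv δ ξ Q' D') (hD' : WeightBound w D' M') :
    IsMatDeriv δ ξ (Q * gram A ξ * Q')
      (matMul D (coeffMat ρ ξ Q') + matMul (coeffMat ρ ξ Q) D') := fun i j =>
  hasSum_mem_graphClosure (fun m => mul_mem_graphClosure hδ (h i m) (h' m j))
    (hξ.hasSum_rinner_mul_rinner hQ Q' i j)
    ((hD.summable_mul (hξ.weightBound_coeffMat Q') hξ.summable_sq i j).hasSum.add
      ((hξ.weightBound_coeffMat Q).summable_mul hD' hξ.summable_sq i j).hasSum)

omit [CompleteSpace X] in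
theorem tsum_sq_nonneg : 0 ≤ ∑' i, w i ^ 2 := tsum_nonneg fun _ => by positivity

/-- The factor `∑ w_i² < 1` is kept in the constant, as it drives the convergence of the
differentiated Neumann series. -/
theorem hasDerivBound_mul_gram (hδ : IsClosedDerivation ρ δ) {S : X →L[ℂ] X}
    (hQ : IsAdjoint A Q S) (h : HasDerivBound δ ξ w Q M) (h' : HasDerivBound δ ξ w Q' M') :
    HasDerivBound δ ξ w (Q * gram A ξ * Q') ((M * ‖Q'‖ + ‖Q‖ * M') * ∑' i, w i ^ 2) := by
  obtain ⟨D, h, hD⟩ := h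
  obtain ⟨D', h', hD'⟩ := h'
  refine ⟨_, hξ.isMatDeriv_mul hδ hQ h hD h' hD', ?_⟩
  rw [add_mul]
  exact (hD.matMul (hξ.weightBound_coeffMat Q') hξ.summable_sq).add
    ((hξ.weightBound_coeffMat Q).matMul hD' hξ.summable_sq)

theorem hasDerivBound_mul (hδ : IsClosedDerivation ρ δ) {S : X →L[ℂ] X}
    (hQ : IsAdjoint A Q S) (h : HasDerivBound δ ξ w Q M) (h' : HasDerivBound δ ξ w Q' M') :
    HasDerivBound δ ξ w (Q * gram A ξ * Q') (M * ‖Q'‖ + ‖Q‖ * M') := by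
  obtain ⟨D, h1, hD⟩ := hξ.hasDerivBound_mul_gram hδ hQ h h'
  refine ⟨D, h1, hD.mono hξ.pos (mul_le_of_le_one_right ?_ hξ.tsum_sq_lt.le)⟩
  have h2 := h.choose_spec.2.nonneg hξ.pos
  have h3 := h'.choose_spec.2.nonneg hξ.pos
  positivity

variable (hδ : IsClosedDerivation ρ δ) (h1 : HasDerivBound δ ξ w 1 1)
include hδ h1

theorem hasDerivBound_neg_gram_pow (m : ℕ) :
    HasDerivBound δ ξ w ((-gram A ξ) ^ m) ((m + 1) * (∑' i, w i ^ 2) ^ m) := by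
  set κ := ∑' i, w i ^ 2 with hκ
  have hκ0 : 0 ≤ κ := hξ.tsum_sq_nonneg
  have hn : ∀ m : ℕ, ‖(-gram A ξ) ^ m‖ ≤ κ ^ m := fun m => by
    induction m with
    | zero => rw [pow_zero, pow_zero]; exact ContinuousLinearMap.norm_id_le
    | succ m ih =>
      rw [pow_succ, pow_succ]
      refine (norm_mul_le _ _).trans (mul_le_mul ih ?_ (norm_nonneg _) (by positivity))
      rw [norm_neg]; exact hξ.norm_gram_le
  induction m with
  | zero => simpa using h1
  | succ m ih =>
    obtain ⟨D, hD, hD'⟩ := hξ.hasDerivBound_mul_gram hδ .one h1 ih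
    refine ⟨-D, ?_, (hD'.mono hξ.pos ?_).neg⟩
    · rw [pow_succ', neg_mul]
      rw [one_mul] at hD
      exact hD.neg
    · have h2 : ‖(1 : X →L[ℂ] X)‖ ≤ 1 := ContinuousLinearMap.norm_id_le
      calc _ ≤ (1 * κ ^ m + 1 * ((m + 1) * κ ^ m)) * κ := by gcongr; exact hn m
        _ = _ := by push_cast; ring

/-- The Neumann series is differentiated term by term: the bounds `(m + 1) κ^m` with `κ = ∑ w_i² <
1` are summable. -/
theorem exists_hasDerivBound_res : ∃ M, HasDerivBound δ ξ w (res A ξ) M := by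
  choose D hD hDb using hξ.hasDerivBound_neg_gram_pow hδ h1
  have hκ : ‖∑' i, w i ^ 2‖ < 1 := by
    rw [Real.norm_of_nonneg hξ.tsum_sq_nonneg]; exact hξ.tsum_sq_lt
  have hs : Summable fun m : ℕ => ((m : ℝ) + 1) * (∑' i, w i ^ 2) ^ m := by
    simp only [add_mul, one_mul]
    refine Summable.add ?_ (summable_geometric_of_norm_lt_one hκ)
    simpa using summable_pow_mul_geometric_of_norm_lt_one 1 hκ
  refine ⟨∑' m : ℕ, ((m : ℝ) + 1) * (∑' i, w i ^ 2) ^ m, fun i j => ∑' m, D m i j,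
    fun i j => ?_, fun i j => ?_⟩
  · refine hasSum_mem_graphClosure (fun m => hD m i j) ?_
      (Summable.of_norm_bounded (hs.mul_right (w i * w j)) fun m => hDb m i j).hasSum
    have h := hξ.hasSum_res (A := A)
    simpa only [ContinuousLinearMap.comp_apply, ContinuousLinearMap.apply_apply, rinnerCLM_apply]
      using ((rinnerCLM A (ξ i)).comp (ContinuousLinearMap.apply ℂ X (ξ j))).hasSum h
  · exact tsum_of_norm_bounded (hs.hasSum.mul_right (w i * w j)) fun m => hDb m i j

/-- The derivatives of the powers of the Cayley transform grow at most quadratically. -/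
theorem exists_hasDerivBound_cay_pow : ∃ C, ∀ n : ℕ,
    HasDerivBound δ ξ w (cay A ξ ^ n) (C * (n + 1) ^ 2) := by
  set r := cay A ξ with hr
  set q := res A ξ + res A ξ with hq
  -- `Z b` satisfies `1 - h Z b = r^b`. Thus `F ↦ F - matMul F (coeffMat ρ ξ (Z b))` is the matrix
  -- version of right multiplication by `r^b`, and it costs only a factor linear in `b` since `‖Z b‖
  -- ≤ ‖q‖ b`.
  set Z : ℕ → (X →L[ℂ] X) := fun b => q * ∑ a ∈ Finset.range b, r ^ a with hZ
  have hκ0 := hξ.tsum_sq_nonneg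
  have hκ1 := hξ.tsum_sq_lt.le
  obtain ⟨Mq, E, hE, hEb⟩ : ∃ M, HasDerivBound δ ξ w q M := by
    obtain ⟨M, E, hE, hEb⟩ := hξ.exists_hasDerivBound_res hδ h1
    exact ⟨_, _, hE.add hE, hEb.add hEb⟩
  have hMq : 0 ≤ Mq := hEb.nonneg hξ.pos
  have hqa : IsAdjoint A q q := hξ.isAdjoint_res.add hξ.isAdjoint_res
  have hra : ∀ n, IsAdjoint A (r ^ n) (r ^ n) := hξ.isAdjoint_cay.pow
  have hZn : ∀ b, ‖Z b‖ ≤ ‖q‖ * b := fun b => by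
    refine (norm_mul_le _ _).trans ?_
    gcongr
    refine (norm_sum_le_of_le _ fun a _ => hξ.norm_cay_pow_le a).trans_eq ?_
    simp
  -- The matrix form of `r^(b+1) = r · r^b`.
  have hZs : ∀ b, Z (b + 1) = q - (q * gram A ξ * Z b - Z b) := fun b => by
    have h2 : gram A ξ * q = 1 - r := hξ.one_sub_cay.symm
    have h3 : q * gram A ξ * Z b = q * ((1 - r) * ∑ a ∈ Finset.range b, r ^ a) := by
      rw [← h2]; simp only [hZ, mul_assoc]
    rw [h3]
    simp only [hZ]
    rw [Finset.sum_range_succ']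
    simp only [pow_succ', ← Finset.mul_sum, pow_zero]
    noncomm_ring
  have hc : ∀ Q, WeightBound w (coeffMat ρ ξ Q) ‖Q‖ := hξ.weightBound_coeffMat
  have hmul : ∀ {F : ℕ → ℕ → B} {L : ℝ} (b : ℕ), WeightBound w F L →
      WeightBound w (F - matMul F (coeffMat ρ ξ (Z b))) (L * (1 + ‖q‖) * (b + 1)) := by
    intro F L b hF
    refine (hF.sub (hF.matMul (hc (Z b)) hξ.summable_sq)).mono hξ.pos ?_
    have hL := hF.nonneg hξ.pos
    calc L + L * ‖Z b‖ * ∑' i, w i ^ 2 ≤ L + L * (‖q‖ * b) * 1 := by gcongr; exact hZn b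
      _ ≤ L + L * (‖q‖ * b) * 1 + (L * b + L * ‖q‖) := le_add_of_nonneg_right (by positivity)
      _ = _ := by ring
  set C := (1 + Mq) * (1 + ‖q‖) with hC
  have hC0 : 0 ≤ C := by positivity
  -- From `r^(n+1) = r^n - r^n h q`, the derivative at `n + 1` is the derivative at `n` acted on by
  -- one step of this right multiplication, minus a term of bounded weight. Bounding `D` after all
  -- shifts `b` at once avoids compounding constants: each step adds one term linear in `n + b`, so
  -- the total is quadratic.
  have key : ∀ n : ℕ, ∃ D, IsMatDeriv δ ξ (r ^ n) D ∧ (∃ M, WeightBound w D M) ∧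
      ∀ b : ℕ, WeightBound w (D - matMul D (coeffMat ρ ξ (Z b))) (C * (n + 1) * (n + b + 1)) := by
    intro n
    induction n with
    | zero =>
      obtain ⟨D, hD, hDb⟩ := h1
      refine ⟨D, hD, ⟨_, hDb⟩, fun b => (hmul b hDb).mono hξ.pos ?_⟩
      rw [Nat.cast_zero, zero_add, mul_one, zero_add, hC]
      gcongr
      linarith
    | succ n ih =>
      obtain ⟨D, hD, ⟨M, hDM⟩, hDb⟩ := ih
      have hE' : WeightBound w (matMul (coeffMat ρ ξ (r ^ n)) E) Mq := by
        refine ((hc _).matMul hEb hξ.summable_sq).mono hξ.pos ?_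
        calc _ ≤ 1 * Mq * 1 := by gcongr; exact hξ.norm_cay_pow_le n
          _ = Mq := by ring
      have hDq := hDM.matMul (hc q) hξ.summable_sq
      refine ⟨D - (matMul D (coeffMat ρ ξ q) + matMul (coeffMat ρ ξ (r ^ n)) E), ?_,
        ⟨_, hDM.sub (hDq.add hE')⟩, fun b => ?_⟩
      · have h2 : r ^ (n + 1) = r ^ n - r ^ n * gram A ξ * q := by
          rw [mul_assoc, ← hξ.one_sub_cay, pow_succ]; noncomm_ring
        rw [h2]
        exact hD.sub (hξ.isMatDeriv_mul hδ (hra n) hD hDM hE hEb)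
      · have h4 : matMul D (coeffMat ρ ξ (Z (b + 1))) = matMul D (coeffMat ρ ξ q) -
            (matMul D (coeffMat ρ ξ (q * gram A ξ * Z b)) - matMul D (coeffMat ρ ξ (Z b))) := by
          rw [hZs, coeffMat_sub,
            matMul_sub_right hDM (hc _) (hc _) hξ.summable_sq, coeffMat_sub,
            matMul_sub_right hDM (hc _) (hc _) hξ.summable_sq]
        have h3 : D - (matMul D (coeffMat ρ ξ q) + matMul (coeffMat ρ ξ (r ^ n)) E) -
            matMul (D - (matMul D (coeffMat ρ ξ q) + matMul (coeffMat ρ ξ (r ^ n)) E))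
              (coeffMat ρ ξ (Z b)) =
            (D - matMul D (coeffMat ρ ξ (Z (b + 1)))) -
              (matMul (coeffMat ρ ξ (r ^ n)) E -
                matMul (matMul (coeffMat ρ ξ (r ^ n)) E) (coeffMat ρ ξ (Z b))) := by
          rw [← sub_sub D, matMul_sub_left (hDM.sub hDq) hE' (hc _) hξ.summable_sq,
            matMul_sub_left hDM hDq (hc _) hξ.summable_sq,
            matMul_assoc hDM (hc _) (hc _) hξ.summable_sq, ← hξ.coeffMat_mul hqa, h4]
          abel
        rw [h3]
        refine ((hDb (b + 1)).sub (hmul b hE')).mono hξ.pos ?_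
        push_cast
        calc C * (n + 1) * (n + (b + 1) + 1) + Mq * (1 + ‖q‖) * (b + 1)
            ≤ C * (n + 1) * (n + (b + 1) + 1) + C * (n + 1 + b + 1) := by
              rw [hC]
              gcongr
              · linarith
              · have : (0 : ℝ) ≤ n := by positivity
                linarith
          _ = _ := by ring
  refine ⟨C, fun n => ?_⟩
  obtain ⟨D, hD, ⟨M, hDM⟩, hDb⟩ := key n
  refine ⟨D, hD, ?_⟩
  have h0 := hDb 0
  have h2 : matMul D (coeffMat ρ ξ (Z 0)) = 0 := by
    ext i j
    simp [hZ, matMul, coeffMat, ← rinnerCLM_apply]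
  rw [h2, sub_zero] at h0
  refine h0.mono hξ.pos (le_of_eq ?_)
  push_cast
  ring

/-- Here 33 = 16 + 1 + 16: two factors `h^16 r^l` with `l` about `N / 2`, separated by the `h` that
the Leibniz rule requires. In each Leibniz term one factor has derivative `O(N²)` and the other has
norm `O(N^(-8))`, whence the exponent 6. -/
theorem exists_hasDerivBound_gram_pow_mul_cay_pow : ∃ C, ∀ N : ℕ,
    HasDerivBound δ ξ w (gram A ξ ^ 33 * cay A ξ ^ N) (C / (N + 1) ^ 6) ∧
    ‖gram A ξ ^ 33 * cay A ξ ^ N‖ ≤ C / (N + 1) ^ 6 := by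
  set h := gram A ξ with hh
  set r := cay A ξ with hr
  have hcomm : ∀ m k, h ^ m * r ^ k = r ^ k * h ^ m := fun m k =>
    (hξ.commute_gram_cay (A := A).pow_pow m k).eq
  have hha : IsAdjoint A h h := hξ.isAdjoint_gram
  have hra : ∀ n, IsAdjoint A (r ^ n) (r ^ n) := hξ.isAdjoint_cay.pow
  obtain ⟨C₁, hC₁⟩ := hξ.exists_hasDerivBound_cay_pow hδ h1
  obtain ⟨C₂, hC₂⟩ := hξ.exists_norm_gram_pow_mul_cay_pow_le (A := A)
  have hC₂0 : 0 ≤ C₂ := le_trans (by positivity) (hC₂ 0)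
  have hh1 : ‖h‖ ≤ 1 := hξ.norm_gram_le.trans hξ.tsum_sq_lt.le
  obtain ⟨M, hM⟩ : ∃ M, HasDerivBound δ ξ w (h ^ 15) M := by
    obtain ⟨D, hD, hDb⟩ := hξ.hasDerivBound_neg_gram_pow hδ h1 15
    refine ⟨_, -D, ?_, hDb.neg⟩
    have h2 := hD.neg
    rwa [Odd.neg_pow (by decide), neg_neg] at h2
  have hM0 : 0 ≤ M := hM.choose_spec.2.nonneg hξ.pos
  have hC₁0 : 0 ≤ C₁ := by simpa using (hC₁ 0).choose_spec.2.nonneg hξ.pos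
  set C₃ := C₁ * ‖h ^ 15‖ + M with hC₃
  have hC₃0 : 0 ≤ C₃ := by positivity
  -- `h^16 r^k = r^k · h · h^15`, so one power of `h` is spent on the Leibniz rule.
  have hv : ∀ k : ℕ, HasDerivBound δ ξ w (h ^ 16 * r ^ k) (C₃ * (k + 1) ^ 2) := fun k => by
    obtain ⟨D, hD, hDb⟩ := hξ.hasDerivBound_mul hδ (hra k) (hC₁ k) hM
    refine ⟨D, ?_, hDb.mono hξ.pos ?_⟩
    · rwa [hcomm, pow_succ' h 15, ← mul_assoc]
    · have hk : (1 : ℝ) ≤ (k + 1) ^ 2 := one_le_pow₀ (by linarith [k.cast_nonneg (α := ℝ)])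
      calc _ ≤ C₁ * (k + 1) ^ 2 * ‖h ^ 15‖ + 1 * M := by gcongr; exact hξ.norm_cay_pow_le k
        _ ≤ C₁ * (k + 1) ^ 2 * ‖h ^ 15‖ + (k + 1) ^ 2 * M := by gcongr
        _ = _ := by rw [hC₃]; ring
  have hvn : ∀ N l : ℕ, N + 1 ≤ 2 * (l + 1) →
      ‖h ^ 16 * r ^ l‖ ≤ 2 ^ 8 * C₂ / (N + 1) ^ 8 := fun N l hl => by
    have hl' : (N : ℝ) + 1 ≤ 2 * (l + 1) := by exact_mod_cast hl
    rw [le_div_iff₀ (by positivity)]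
    calc _ ≤ ‖h ^ 16 * r ^ l‖ * (2 * (l + 1)) ^ 8 := by gcongr
      _ = 2 ^ 8 * (‖h ^ 16 * r ^ l‖ * (l + 1) ^ 8) := by rw [mul_pow]; ring
      _ ≤ _ := by gcongr; exact hC₂ l
  refine ⟨2 * C₃ * (2 ^ 8 * C₂) + 2 ^ 8 * C₂ * C₂, fun N => ?_⟩
  have hu : h ^ 33 * r ^ N = h ^ 16 * r ^ (N / 2) * h * (h ^ 16 * r ^ (N - N / 2)) := by
    have h2 := hcomm 17 (N / 2)
    calc h ^ 33 * r ^ N = h ^ 16 * (h ^ 17 * r ^ (N / 2)) * r ^ (N - N / 2) := by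
          rw [← mul_assoc, ← pow_add, mul_assoc, ← pow_add,
            Nat.add_sub_cancel' (Nat.div_le_self N 2)]
      _ = _ := by rw [h2, pow_succ' h 16]; simp only [mul_assoc]
  have hN : (1 : ℝ) ≤ N + 1 := by linarith [N.cast_nonneg (α := ℝ)]
  have ha := hvn N (N / 2) (by omega)
  have hb := hvn N (N - N / 2) (by omega)
  rw [hu]
  constructor
  · obtain ⟨D, hD, hDb⟩ := hξ.hasDerivBound_mul hδ ((hha.pow 16).mul (hra (N / 2)))
      (hv (N / 2)) (hv (N - N / 2))
    refine ⟨D, hD, hDb.mono hξ.pos ?_⟩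
    calc _ ≤ C₃ * (N + 1) ^ 2 * (2 ^ 8 * C₂ / (N + 1) ^ 8) +
          2 ^ 8 * C₂ / (N + 1) ^ 8 * (C₃ * (N + 1) ^ 2) := by
          gcongr
          · exact Nat.div_le_self N 2
          · exact Nat.sub_le _ _
      _ = 2 * C₃ * (2 ^ 8 * C₂) / (N + 1) ^ 6 := by field_simp; ring
      _ ≤ _ := by gcongr; exact le_add_of_nonneg_right (by positivity)
  · have hb' : ‖h ^ 16 * r ^ (N - N / 2)‖ ≤ C₂ := by
      refine le_trans (le_mul_of_one_le_right (norm_nonneg _) ?_) (hC₂ (N - N / 2))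
      exact one_le_pow₀ (by linarith [(N - N / 2).cast_nonneg (α := ℝ)])
    calc _ ≤ ‖h ^ 16 * r ^ (N / 2)‖ * ‖h‖ * ‖h ^ 16 * r ^ (N - N / 2)‖ := norm_mul₃_le
      _ ≤ 2 ^ 8 * C₂ / (N + 1) ^ 8 * 1 * C₂ := by gcongr
      _ = 2 ^ 8 * C₂ * C₂ / (N + 1) ^ 8 := by ring
      _ ≤ 2 ^ 8 * C₂ * C₂ / (N + 1) ^ 6 := by gcongr; norm_num
      _ ≤ _ := by gcongr; exact le_add_of_nonneg_left (by positivity)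

/-- The outer factors `q` come from the frame vectors. Attaching them to `h^33 r^N` uses three more
powers of `h`: two separators and one inside `p = h q`. The total 36 is even, so that `h^36` is the
square of `h^18`. -/
theorem exists_hasDerivBound_frame : ∃ C, ∀ N : ℕ,
    HasDerivBound δ ξ w ((res A ξ + res A ξ) * gram A ξ ^ 36 * cay A ξ ^ N *
      (res A ξ + res A ξ)) (C / (N + 1) ^ 6) ∧
    ‖(res A ξ + res A ξ) * gram A ξ ^ 36 * cay A ξ ^ N * (res A ξ + res A ξ)‖ ≤
      C / (N + 1) ^ 6 := by
  set h := gram A ξ with hh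
  set r := cay A ξ with hr
  set q := res A ξ + res A ξ with hq
  have hha : IsAdjoint A h h := hξ.isAdjoint_gram
  have hqa : IsAdjoint A q q := hξ.isAdjoint_res.add hξ.isAdjoint_res
  have hra : ∀ n, IsAdjoint A (r ^ n) (r ^ n) := hξ.isAdjoint_cay.pow
  obtain ⟨C, hC⟩ := hξ.exists_hasDerivBound_gram_pow_mul_cay_pow hδ h1
  have hC0 : 0 ≤ C := by simpa using (norm_nonneg _).trans (hC 0).2
  obtain ⟨Mq, hMq⟩ : ∃ M, HasDerivBound δ ξ w q M := by
    obtain ⟨M, E, hE, hEb⟩ := hξ.exists_hasDerivBound_res hδ h1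
    exact ⟨_, _, hE.add hE, hEb.add hEb⟩
  have hMq0 : 0 ≤ Mq := hMq.choose_spec.2.nonneg hξ.pos
  obtain ⟨M, hM⟩ : ∃ M, HasDerivBound δ ξ w (1 * h * q) M :=
    ⟨_, hξ.hasDerivBound_mul hδ .one h1 hMq⟩
  have hM0 : 0 ≤ M := hM.choose_spec.2.nonneg hξ.pos
  set p := 1 * h * q with hp
  refine ⟨C * (Mq * (‖h‖ * ‖p‖) + ‖q‖ * (‖p‖ + M)) + C * (‖q‖ * ‖h‖ * (‖h‖ * ‖p‖)), fun N => ?_⟩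
  obtain ⟨hu, hun⟩ := hC N
  set L := C / ((N : ℝ) + 1) ^ 6 with hL
  have hL0 : 0 ≤ L := by positivity
  set u := h ^ 33 * r ^ N with hu'
  have hQ : q * h ^ 36 * r ^ N * q = q * h * (u * h * p) := by
    have h2 : r ^ N * h * h = h * h * r ^ N := by
      have := (hξ.commute_gram_cay (A := A).pow_pow 2 N).eq
      rw [sq] at this
      rw [mul_assoc]; exact this.symm
    calc q * h ^ 36 * r ^ N * q = q * h * h ^ 33 * (h * h * r ^ N) * q := by
          simp only [mul_assoc, pow_succ, pow_zero, one_mul]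
      _ = _ := by rw [← h2, hp, hu']; simp only [mul_assoc, one_mul]
  have hn : ‖u * h * p‖ ≤ L * (‖h‖ * ‖p‖) := by
    calc _ ≤ ‖u‖ * ‖h‖ * ‖p‖ := norm_mul₃_le
      _ ≤ L * ‖h‖ * ‖p‖ := by gcongr
      _ = _ := mul_assoc _ _ _
  rw [hQ]
  constructor
  · obtain ⟨D, hD, hDb⟩ := hξ.hasDerivBound_mul hδ hqa hMq
      (hξ.hasDerivBound_mul hδ ((hha.pow 33).mul (hra N)) hu hM)
    refine ⟨D, hD, hDb.mono hξ.pos ?_⟩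
    calc _ ≤ Mq * (L * (‖h‖ * ‖p‖)) + ‖q‖ * (L * ‖p‖ + L * M) := by gcongr
      _ = C * (Mq * (‖h‖ * ‖p‖) + ‖q‖ * (‖p‖ + M)) / (N + 1) ^ 6 := by rw [hL]; ring
      _ ≤ _ := by gcongr; exact le_add_of_nonneg_right (by positivity)
  · calc _ ≤ ‖q‖ * ‖h‖ * ‖u * h * p‖ := norm_mul₃_le
      _ ≤ ‖q‖ * ‖h‖ * (L * (‖h‖ * ‖p‖)) := by gcongr
      _ = C * (‖q‖ * ‖h‖ * (‖h‖ * ‖p‖)) / (N + 1) ^ 6 := by rw [hL]; ring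
      _ ≤ _ := by gcongr; exact le_add_of_nonneg_left (by positivity)

end IsSmallFamily

end Derivatives

/-! ### Rescaling the generators, differentiability of `W h^36 W*`, and the conclusion. -/

section Main

variable {A B X : Type*}
  [NonUnitalCStarAlgebra A] [PartialOrder A] [StarOrderedRing A]
  [NonUnitalCStarAlgebra B]
  [NormedAddCommGroup X] [NormedSpace ℂ X] [SMul Aᵐᵒᵖ X] [CStarModule Aᵐᵒᵖ X]
  {𝒜 : NonUnitalStarSubalgebra ℂ A}

/-- Generators with mutual inner products in the domain of `δ` can be rescaled so that they and the
derivatives of their inner products become small. -/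
theorem exists_isSmallFamily (δ : 𝒜 →ₗ[ℂ] B) {ξ : ℕ → X}
    (hξ : ∀ n m, rinner A (ξ n) (ξ m) ∈ 𝒜) (hd : Dense (rightSpan A ξ)) :
    ∃ (ζ : ℕ → X) (w : ℕ → ℝ), IsSmallFamily ζ w ∧ HasDerivBound δ ζ w 1 1 ∧
      Dense (rightSpan A ζ) := by
  set d : ℕ → ℕ → B := fun i j => δ ⟨_, hξ i j⟩ with hdef
  -- `s l` dominates every `‖d i j‖` with `i, j ≤ l`, so the scalar of the larger index alone can
  -- absorb the derivative of `⟨ξ_i, ξ_j⟩`.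
  set s : ℕ → ℝ := fun i =>
    ∑ j ∈ Finset.range (i + 1), ∑ k ∈ Finset.range (i + 1), ‖d j k‖ with hs
  have hs0 : ∀ i, 0 ≤ s i := fun i =>
    Finset.sum_nonneg fun _ _ => Finset.sum_nonneg fun _ _ => norm_nonneg _
  have hds : ∀ l i j, i ≤ l → j ≤ l → ‖d i j‖ ≤ s l := fun l i j hi hj =>
    (Finset.single_le_sum (f := fun k => ‖d i k‖) (fun _ _ => norm_nonneg _)
      (Finset.mem_range.2 (Nat.lt_succ_of_le hj))).trans
      (Finset.single_le_sum (f := fun j => ∑ k ∈ Finset.range (l + 1), ‖d j k‖)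
        (fun _ _ => Finset.sum_nonneg fun _ _ => norm_nonneg _)
        (Finset.mem_range.2 (Nat.lt_succ_of_le hi)))
  set w : ℕ → ℝ := fun i => (1 / 2) ^ (i + 1) with hw
  have hw0 : ∀ i, 0 < w i := fun i => by positivity
  set c : ℕ → ℝ := fun i => w i / (1 + ‖ξ i‖ + s i) with hc
  have hden : ∀ i, 0 < 1 + ‖ξ i‖ + s i := fun i => by linarith [norm_nonneg (ξ i), hs0 i]
  have hc0 : ∀ i, 0 < c i := fun i => div_pos (hw0 i) (hden i)
  have hcw : ∀ i, c i * (1 + ‖ξ i‖ + s i) = w i := fun i => div_mul_cancel₀ _ (hden i).ne'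
  have hcle : ∀ i, c i ≤ w i := fun i =>
    div_le_self (hw0 i).le (by linarith [norm_nonneg (ξ i), hs0 i])
  have hcs : ∀ i, c i * s i ≤ w i := fun i => by
    rw [← hcw i]
    exact mul_le_mul_of_nonneg_left (by linarith [norm_nonneg (ξ i)]) (hc0 i).le
  have hsq : HasSum (fun i => w i ^ 2) (1 / 3) := by
    have h := (hasSum_geometric_of_lt_one (r := (1 / 4 : ℝ)) (by norm_num) (by norm_num)).mul_left
      (1 / 4)
    have h2 : (1 / 4 : ℝ) * (1 - 1 / 4)⁻¹ = 1 / 3 := by norm_num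
    rw [h2] at h
    refine h.congr_fun fun i => ?_
    simp only [hw]
    rw [← pow_mul, mul_comm, pow_mul, pow_succ]
    norm_num
    ring
  refine ⟨fun i => (c i : ℂ) • ξ i, w, ⟨hw0, ?_, hsq.summable, ?_, fun i => ?_⟩, ?_, ?_⟩
  · exact (summable_nat_add_iff 1).2 (summable_geometric_of_lt_one (by norm_num) (by norm_num))
  · rw [hsq.tsum_eq]; norm_num
  · rw [norm_smul, Complex.norm_real, Real.norm_of_nonneg (hc0 i).le, ← hcw i]
    exact mul_le_mul_of_nonneg_left (by linarith [hs0 i]) (hc0 i).le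
  · refine ⟨fun i j => ((c i * c j : ℝ) : ℂ) • d i j, fun i j => ?_, fun i j => ?_⟩
    · have h := (graphClosure δ).smul_mem ((c i * c j : ℝ) : ℂ)
        (mem_graphClosure δ ⟨_, hξ i j⟩)
      have h2 : rinner A ((c i : ℂ) • ξ i) ((c j : ℂ) • ξ j) =
          ((c i * c j : ℝ) : ℂ) • rinner A (ξ i) (ξ j) := by
        rw [rinner_smul_complex_left, rinner_smul_complex_right, smul_smul]
        simp
      rw [one_apply_eq_self, h2]
      exact h
    · rw [norm_smul, Complex.norm_real, Real.norm_of_nonneg (mul_pos (hc0 i) (hc0 j)).le, one_mul]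
      have hci := (hc0 i).le
      have hcj := (hc0 j).le
      have hwi := (hw0 i).le
      have hwj := (hw0 j).le
      rcases le_total i j with h | h
      · calc c i * c j * ‖d i j‖ ≤ c i * c j * s j := by gcongr; exact hds j i j h le_rfl
          _ = c i * (c j * s j) := mul_assoc _ _ _
          _ ≤ _ := mul_le_mul (hcle i) (hcs j) (mul_nonneg hcj (hs0 j)) hwi
      · calc c i * c j * ‖d i j‖ ≤ c i * c j * s i := by gcongr; exact hds i i j le_rfl h
          _ = (c i * s i) * c j := by ring
          _ ≤ _ := mul_le_mul (hcs i) (hcle j) hcj hwi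
  · refine hd.mono ?_
    rintro _ ⟨N, a, rfl⟩
    refine ⟨N, fun n => (c n : ℂ)⁻¹ • a n, Finset.sum_congr rfl fun n _ => ext_rinner (A := A)
      fun z => ?_⟩
    rw [rinner_smul_right, rinner_smul_right, rinner_smul_complex_right, smul_mul_smul_comm,
      mul_inv_cancel₀ (by exact_mod_cast (hc0 n).ne'), one_smul]

/-- The weights of the frame of a small family are absolutely summable. -/
theorem summable_weight_unpair {w : ℕ → ℝ} (hw : ∀ i, 0 < w i) (hs : Summable w) :
    Summable fun n : ℕ => w n.unpair.2 / ((n.unpair.1 : ℝ) + 1) ^ 2 := by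
  have h1 : Summable fun k : ℕ => 1 / ((k : ℝ) + 1) ^ 2 := by
    have := (summable_nat_add_iff 1).2 (Real.summable_one_div_nat_pow.2 one_lt_two)
    simpa using this
  have h2 := h1.mul_of_nonneg hs (fun _ => by positivity) fun i => (hw i).le
  refine (Nat.pairEquiv.symm.summable_iff.2 h2).congr fun n => ?_
  simp only [Function.comp_apply, Nat.pairEquiv_symm_apply]
  ring

variable [PartialOrder B] [StarOrderedRing B] [CompleteSpace X]
  {ρ : A →⋆ₙₐ[ℂ] B} {δ : 𝒜 →ₗ[ℂ] B} {ξ : ℕ → X} {w : ℕ → ℝ}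

theorem IsSmallFamily.analysis_comp_mem_diffCompactOps (hξ : IsSmallFamily ξ w)
    (hδ : IsClosedDerivation ρ δ) (h1 : HasDerivBound δ ξ w 1 1) (hd : Dense (rightSpan A ξ)) :
    (hξ.isParsevalFrame hd).analysis ∘L (gram A ξ ^ 36) ∘L (hξ.isParsevalFrame hd).synthesis ∈
      diffCompactOps δ := by
  set hη := hξ.isParsevalFrame hd
  set q := res A ξ + res A ξ with hq
  set r := cay A ξ with hr
  set η : ℕ → X := fun n => q ((r ^ n.unpair.1) (ξ n.unpair.2)) with hηdef
  obtain ⟨C, hC⟩ := hξ.exists_hasDerivBound_frame hδ h1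
  have hC0 : 0 ≤ C := by simpa using (norm_nonneg _).trans (hC 0).2
  choose D hD hDb using fun N => (hC N).1
  set Q : ℕ → X →L[ℂ] X := fun N => q * gram A ξ ^ 36 * r ^ N * q with hQ
  have hqa : IsAdjoint A q q := hξ.isAdjoint_res.add hξ.isAdjoint_res
  have hra : ∀ n, IsAdjoint A (r ^ n) (r ^ n) := hξ.isAdjoint_cay.pow
  have hcr : ∀ n, Commute q (r ^ n) := fun n =>
    (hξ.commute_res_cay (A := A).add_left hξ.commute_res_cay).pow_right n
  -- All factors commute, so the powers of `r` from the two frame vectors merge into `r^(k+l)`.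
  have hentry : ∀ m n, rinner A (η m) ((gram A ξ ^ 36) (η n)) =
      rinner A (ξ m.unpair.2) (Q (m.unpair.1 + n.unpair.1) (ξ n.unpair.2)) := fun m n => by
    simp only [hηdef]
    rw [hqa, hra]
    have h : r ^ m.unpair.1 * (q * (gram A ξ ^ 36 * (q * r ^ n.unpair.1))) =
        Q (m.unpair.1 + n.unpair.1) := by
      have h2 : gram A ξ ^ 36 * r ^ m.unpair.1 = r ^ m.unpair.1 * gram A ξ ^ 36 :=
        (hξ.commute_gram_cay (A := A).pow_pow 36 m.unpair.1).eq
      rw [(hcr _).eq, ← mul_assoc, ← (hcr _).eq, mul_assoc, ← mul_assoc (r ^ _) (gram A ξ ^ 36),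
        ← h2]
      simp only [hQ, pow_add, mul_assoc]
    exact congrArg _ (DFunLike.congr_fun h _)
  set f : ℕ → ℝ := fun n => w n.unpair.2 / ((n.unpair.1 : ℝ) + 1) ^ 2 with hf
  have hf0 : ∀ n, 0 ≤ f n := fun n => div_nonneg (hξ.pos _).le (by positivity)
  have hfs : Summable f := summable_weight_unpair hξ.pos hξ.summable
  -- Since `(k + 1)(l + 1) ≤ (k + l + 1)²`, decay in `k + l` yields a product of summable weights in
  -- `m` and `n`.
  have hle : ∀ p : ℕ × ℕ, C / (((p.1.unpair.1 + p.2.unpair.1 : ℕ) : ℝ) + 1) ^ 6 *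
      (w p.1.unpair.2 * w p.2.unpair.2) ≤ C * (f p.1 * f p.2) := by
    rintro ⟨m, n⟩
    set k : ℝ := (m.unpair.1 : ℝ)
    set l : ℝ := (n.unpair.1 : ℝ)
    have hk : 0 ≤ k := Nat.cast_nonneg _
    have hl : 0 ≤ l := Nat.cast_nonneg _
    have h2 : (k + 1) ^ 2 * (l + 1) ^ 2 ≤ (k + l + 1) ^ 6 := by
      calc _ = ((k + 1) * (l + 1)) ^ 2 := by ring
        _ ≤ ((k + l + 1) * (k + l + 1)) ^ 2 := by gcongr <;> linarith
        _ = (k + l + 1) ^ 4 := by ring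
        _ ≤ _ := pow_le_pow_right₀ (by linarith) (by norm_num)
    have hfm : f m = w m.unpair.2 / (k + 1) ^ 2 := rfl
    have hfn : f n = w n.unpair.2 / (l + 1) ^ 2 := rfl
    have hw1 := (hξ.pos m.unpair.2).le
    have hw2 := (hξ.pos n.unpair.2).le
    push_cast
    calc C / (k + l + 1) ^ 6 * (w m.unpair.2 * w n.unpair.2)
        ≤ C / ((k + 1) ^ 2 * (l + 1) ^ 2) * (w m.unpair.2 * w n.unpair.2) := by gcongr
      _ = C * (f m * f n) := by rw [hfm, hfn, div_mul_div_comm, mul_div_assoc', div_mul_eq_mul_div]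
  refine mem_diffCompactOps_of_summable
    (a := fun m n => rinner A (η m) ((gram A ξ ^ 36) (η n)))
    (b := fun m n => D (m.unpair.1 + n.unpair.1) m.unpair.2 n.unpair.2)
    (g := fun p => C * (f p.1 * f p.2)) (fun m n => ?_)
    ((hfs.mul_of_nonneg hfs hf0 hf0).mul_left C) (fun p => ?_) (fun p => ?_) fun x m => ?_
  · rw [hentry]
    exact hD _ _ _
  · rw [hentry]
    refine (hξ.norm_rinner_apply_le _ _ _).trans (le_trans ?_ (hle p))
    exact mul_le_mul_of_nonneg_right (hC _).2 (mul_pos (hξ.pos _) (hξ.pos _)).le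
  · exact (hDb _ _ _).trans (hle p)
  · have h := (StdModule.summable (hη.analysis ((gram A ξ ^ 36) (η m))) x).hasSum
    rw [← StdModule.rinner_eq, hη.isAdjoint_analysis, hξ.isAdjoint_gram.pow 36] at h
    simp only [hη.analysis_apply, star_rinner, hξ.isAdjoint_gram.pow 36 _ _] at h
    exact h

end Main

end DiffAbsorption

open DiffAbsorption in
theorem theoremt {A B X : Type*}
    [NonUnitalCStarAlgebra A] [PartialOrder A] [StarOrderedRing A]
    [NonUnitalCStarAlgebra B] [PartialOrder B] [StarOrderedRing B]
    [NormedAddCommGroup X] [NormedSpace ℂ X] [CompleteSpace X] [SMul Aᵐᵒᵖ X] [CStarModule Aᵐᵒᵖ X]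
    (ρ : A →⋆ₙₐ[ℂ] B) (hρ : Function.Injective ρ)
    (𝒜 : NonUnitalStarSubalgebra ℂ A) (h𝒜 : Dense (𝒜 : Set A))
    (δ : 𝒜 →ₗ[ℂ] B) (hδ : IsClosedDerivation ρ δ)
    (hX : ∃ ξ : ℕ → X, (∀ n m, rinner A (ξ n) (ξ m) ∈ 𝒜) ∧ Dense (rightSpan A ξ)) :
    ∃ (W : X →L[ℂ] StdModule A) (W' : StdModule A →L[ℂ] X)
      (K : StdModule A →L[ℂ] StdModule A),
      IsAdjoint A W W' ∧
      (∀ x y, rinner A (W x) (W y) = rinner A x y) ∧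
      IsPositiveOp A K ∧
      K ∘L (W ∘L W') = (W ∘L W') ∘L K ∧
      DenseRange (W' ∘L K ∘L W) ∧
      (W ∘L W') ∘L K ∈ compactOps A ∧
      (W ∘L W') ∘L (K ∘L K) ∈ diffCompactOps δ := by
  obtain ⟨ξ₀, hξ₀, hd₀⟩ := hX
  obtain ⟨ξ, w, hξ, h1, hd⟩ := exists_isSmallFamily δ hξ₀ hd₀
  have hη := hξ.isParsevalFrame hd
  set h := gram A ξ with hh
  have hha : ∀ n, IsAdjoint A (h ^ n) (h ^ n) := hξ.isAdjoint_gram.pow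
  have hW := hη.isAdjoint_analysis
  have hWW : ∀ x, hη.synthesis (hη.analysis x) = x := hη.synthesis_analysis
  have hK : (hη.analysis ∘L hη.synthesis) ∘L (hη.analysis ∘L (h ^ 18) ∘L hη.synthesis) =
      hη.analysis ∘L (h ^ 18) ∘L hη.synthesis := by
    ext1 x
    simp only [ContinuousLinearMap.comp_apply, hWW]
  -- `K = W h^18 W*`, chosen so that `P K² = W h^36 W*` is the operator whose matrix was estimated.
  refine ⟨hη.analysis, hη.synthesis, hη.analysis ∘L (h ^ 18) ∘L hη.synthesis, hW,
    hη.rinner_analysis, ⟨hW.comp ((hha 18).comp hW.symm), fun x => ?_⟩, ?_, ?_, ?_, ?_⟩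
  · have h2 : (h ^ 18) (hη.synthesis x) = (h ^ 9) ((h ^ 9) (hη.synthesis x)) := by
      rw [← mul_apply_eq_comp, ← pow_add]
    simp only [ContinuousLinearMap.comp_apply]
    rw [← hW.symm, h2, ← hha 9]
    exact rinner_self_nonneg _
  · rw [hK]
    ext1 x
    simp only [ContinuousLinearMap.comp_apply, hWW]
  · have h2 : hη.synthesis ∘L (hη.analysis ∘L (h ^ 18) ∘L hη.synthesis) ∘L hη.analysis = h ^ 18 := by
      ext1 x
      simp only [ContinuousLinearMap.comp_apply, hWW]
    rw [h2]
    exact hξ.denseRange_gram_pow hd 18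
  · rw [hK, pow_succ' h 17]
    exact comp_mem_compactOps hW ((hha 17).comp hW.symm) hξ.gram_mem_compactOps
  · have h2 : (hη.analysis ∘L hη.synthesis) ∘L ((hη.analysis ∘L (h ^ 18) ∘L hη.synthesis) ∘L
        (hη.analysis ∘L (h ^ 18) ∘L hη.synthesis)) =
        hη.analysis ∘L (h ^ 36) ∘L hη.synthesis := by
      ext1 x
      simp only [ContinuousLinearMap.comp_apply, hWW]
      rw [← mul_apply_eq_comp (h ^ 18), ← pow_add]
    rw [h2]
    exact hξ.analysis_comp_mem_diffCompactOps hδ h1 hd
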